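/- Let $p,q\ge 0$, let $\mathbb R^{p,q}$ be $\mathbb R^{p+q}$ with the metric $x_1^2+\dots+x_p^2-x_{p+1}^2-\dots-x_{p+q}^2$, let $\mathrm O(p,q)$ be its group of linear isometries, with Lie algebra $\mathfrak o(p,q)$, and let $\mathrm{IO}(p,q)=\mathrm O(p,q)\ltimes\mathbb R^{p,q}$, with Lie algebra $\mathfrak{io}(p,q)=\mathfrak o(p,q)\oplus\mathbb R^{p,q}$. The teleparallel 2-group $\mathbf{Tel}(p,q)$ is the Lie 2-group with crossed module $(G,H,t,\alpha)$, where $G=\mathrm{IO}(p,q)$, $H=\mathbb R^{p,q}$, $t(v)=(1,v)$ and $\alpha(g,v)w=gw$; differentiating gives $\underline t(v)=(0,v)\in\mathfrak{io}(p,q)$ and $\underline\alpha(\xi,v)w=\xi w$. Let $M$ be a smooth (finite-dimensional) manifold. A 2-connection on the trivial principal $\mathbf{Tel}(p,q)$ 2-bundle over $M$ is a pair $(A,B)$ of a smooth $\mathfrak{io}(p,q)$-valued 1-form $A$ and a smooth $\mathbb R^{p,q}$-valued 2-form $B$ on $M$ satisfying the fake flatness condition $dA+A\wedge A=\underline t(B)$,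 where $A\wedge A=\tfrac12[A,A]$. A weak $\mathbf{Tel}(p,q)$ gauge transformation is a pair $(g,a)$ of a smooth map $g\colon M\to\mathrm{IO}(p,q)$ and a smooth $\mathbb R^{p,q}$-valued 1-form $a$ on $M$; it takes $(A,B)$ to $(A',B')$, where $$A'=gAg^{-1}+g\,dg^{-1}+\underline t(a),\qquad B'=\alpha(g)(B)+d_{A'}a+a\wedge a,\qquad d_{A'}a=da+\underline\alpha(A')\wedge a,$$ and $a\wedge a$ is formed with the (zero) Lie bracket of $\mathbb R^{p,q}$. **Theorem.** If $\pi_1(M,x)$ is trivial for every $x\in M$, then for any two 2-connections $(A,B)$ and $(A',B')$ on the trivial principal $\mathbf{Tel}(p,q)$ 2-bundle over $M$ there is a weak $\mathbf{Tel}(p,q)$ gauge transformation taking $(A,B)$ to $(A',B')$. -/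

import Mathlib

open scoped Manifold ContDiff

noncomputable section

namespace Teleparallel

/-! ### Differential forms on a manifold modelled on `E`, with values in a normed space `F` -/

section Forms

variable (E : Type*) [NormedAddCommGroup E] [NormedSpace ℝ E]
  (M : Type*) [TopologicalSpace M] [ChartedSpace E M]
  (F : Type*) [NormedAddCommGroup F] [NormedSpace ℝ F]

/-- `F`-valued differential `n`-forms on `M` (no smoothness imposed yet): an alternating
`n`-linear map on every tangent space. -/
abbrev DiffForm (n : ℕ) : Type _ :=
  (x : M) → TangentSpace 𝓘(ℝ, E) x [⋀^Fin n]→L[ℝ] F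

variable {E M F}

/-- The coordinate expression of the form `θ` in the chart around `x₀`: its pullback along the
inverse of that chart. It is meaningful on the target of the chart. -/
def DiffForm.inChart {n : ℕ} (θ : DiffForm E M F n) (x₀ : M) : E → E [⋀^Fin n]→L[ℝ] F :=
  fun y ↦ (θ ((extChartAt 𝓘(ℝ, E) x₀).symm y)).compContinuousLinearMap
    (mfderiv 𝓘(ℝ, E) 𝓘(ℝ, E) (extChartAt 𝓘(ℝ, E) x₀).symm y)

/-- A form is smooth if all its coordinate expressions are. -/
def DiffForm.Smooth {n : ℕ} (θ : DiffForm E M F n) : Prop :=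
  ∀ x₀ : M, ContDiffOn ℝ ∞ (θ.inChart x₀) (extChartAt 𝓘(ℝ, E) x₀).target

/-- The exterior derivative `dθ`. At `x` it is computed in the chart around `x` and pulled back to
the tangent space at `x`. For a `1`-form, in coordinates,
`dθ (u, v) = D_u (θ v) - D_v (θ u)` for constant `u`, `v`. -/
def DiffForm.d {n : ℕ} (θ : DiffForm E M F n) : DiffForm E M F (n + 1) :=
  fun x ↦ (extDeriv (θ.inChart x) (extChartAt 𝓘(ℝ, E) x x)).compContinuousLinearMap
    (mfderiv 𝓘(ℝ, E) 𝓘(ℝ, E) (extChartAt 𝓘(ℝ, E) x) x)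

end Forms

/-! An associative algebra is a Lie algebra with its commutator as bracket. -/

attribute [local instance] LieRing.ofAssociativeRing

/-! ### The groups `O(p,q)` and `IO(p,q)` and their Lie algebras -/

/-- The vector space `ℝ^{p,q}`, as a Lie algebra with the componentwise commutator of real
numbers, that is, with zero bracket. -/
abbrev Rpq (p q : ℕ) : Type := Fin p ⊕ Fin q → ℝ

variable (p q : ℕ)

/-- The metric of signature `(p,q)` on `ℝ^{p,q}`. -/
def metric (x y : Rpq p q) : ℝ :=
  ∑ i, x (Sum.inl i) * y (Sum.inl i) - ∑ j, x (Sum.inr j) * y (Sum.inr j)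

/-- The Lorentz group `O(p,q)`: linear isometries of `ℝ^{p,q}`. -/
def Opq : Subgroup (Rpq p q →L[ℝ] Rpq p q)ˣ where
  carrier := {g | ∀ x y, metric p q (g.val x) (g.val y) = metric p q x y}
  one_mem' := fun x y ↦ rfl
  mul_mem' := by
    intro g h hg hh x y
    have := hg (h.val x) (h.val y)
    simpa [hh x y] using this
  inv_mem' := by
    intro g hg x y
    have key : ∀ z, g.val ((g⁻¹).val z) = z := fun z ↦ by
      rw [← mul_apply_eq_comp, Units.mul_inv, one_apply_eq_self]
    have := hg ((g⁻¹).val x) ((g⁻¹).val y)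
    rw [key, key] at this
    exact this.symm

/-- The Lie algebra `𝔬(p,q)`: linear maps that are skew for the metric. -/
def opq : LieSubalgebra ℝ (Rpq p q →L[ℝ] Rpq p q) where
  carrier := {ξ | ∀ x y, metric p q (ξ x) y + metric p q x (ξ y) = 0}
  zero_mem' := by intro x y; simp [metric]
  add_mem' := by
    intro ξ ζ hξ hζ x y
    have h1 := hξ x y
    have h2 := hζ x y
    simp only [metric, add_apply, Pi.add_apply, add_mul, mul_add,
      Finset.sum_add_distrib] at *
    linarith
  smul_mem' := by
    intro c ξ hξ x y
    have h := hξ x y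
    have e1 : metric p q ((c • ξ) x) y = c * metric p q (ξ x) y := by
      simp [metric, mul_sub, Finset.mul_sum, mul_assoc]
    have e2 : metric p q x ((c • ξ) y) = c * metric p q x (ξ y) := by
      simp [metric, mul_sub, Finset.mul_sum, mul_left_comm]
    rw [e1, e2, ← mul_add, h, mul_zero]
  lie_mem' := by
    intro ξ ζ hξ hζ x y
    have h1 := hξ (ζ x) y
    have h2 := hζ (ξ x) y
    have h3 := hξ x (ζ y)
    have h4 := hζ x (ξ y)
    have e1 : metric p q (⁅ξ, ζ⁆ x) y = metric p q (ξ (ζ x)) y - metric p q (ζ (ξ x)) y := by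
      simp only [metric, LieRing.of_associative_ring_bracket, sub_apply,
        mul_apply_eq_comp, Pi.sub_apply, sub_mul, Finset.sum_sub_distrib]
      ring
    have e2 : metric p q x (⁅ξ, ζ⁆ y) = metric p q x (ξ (ζ y)) - metric p q x (ζ (ξ y)) := by
      simp only [metric, LieRing.of_associative_ring_bracket, sub_apply,
        mul_apply_eq_comp, Pi.sub_apply, mul_sub, Finset.sum_sub_distrib]
      ring
    rw [e1, e2]
    linarith

/-- The standard action of `O(p,q)` on the translation group `ℝ^{p,q}` (written
multiplicatively). -/
def rotationAction : Opq p q →* MulAut (Multiplicative (Rpq p q)) where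
  toFun g :=
    { toFun := fun w ↦ Multiplicative.ofAdd (g.val.val w.toAdd)
      invFun := fun w ↦ Multiplicative.ofAdd (g⁻¹.val.val w.toAdd)
      left_inv := fun w ↦ by
        apply Multiplicative.toAdd.injective
        change (g⁻¹.val.val * g.val.val) w.toAdd = w.toAdd
        simp
      right_inv := fun w ↦ by
        apply Multiplicative.toAdd.injective
        change (g.val.val * g⁻¹.val.val) w.toAdd = w.toAdd
        simp
      map_mul' := fun v w ↦ by simp }
  map_one' := by ext w; rfl
  map_mul' := fun g h ↦ by ext w; rfl

/-- The Poincaré group `IO(p,q) = O(p,q) ⋉ ℝ^{p,q}`; the element `(g, v)` has `right` component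
`g` and `left` component `v`, and `(g, v) (g', v') = (g g', v + g v')`. -/
abbrev IOpq : Type := Multiplicative (Rpq p q) ⋊[rotationAction p q] Opq p q

/-- The associative algebra of linear endomorphisms of `ℝ^{p,q} × ℝ`, in which the Poincaré group
and its Lie algebra are realised as affine transformations. -/
abbrev AffEnd : Type := (Rpq p q × ℝ) →L[ℝ] (Rpq p q × ℝ)

variable {p q}

/-- The block matrix with rows `(ξ, v)` and `(0, c)`: it sends `(x, s)` to `(ξ x + s v, c s)`. -/
def block (ξ : Rpq p q →L[ℝ] Rpq p q) (v : Rpq p q) (c : ℝ) : AffEnd p q :=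
  ((ξ.comp (ContinuousLinearMap.fst ℝ (Rpq p q) ℝ)) +
    (ContinuousLinearMap.snd ℝ (Rpq p q) ℝ).smulRight v).prod
      (c • ContinuousLinearMap.snd ℝ (Rpq p q) ℝ)

@[simp] theorem block_apply (ξ : Rpq p q →L[ℝ] Rpq p q) (v : Rpq p q) (c : ℝ)
    (z : Rpq p q × ℝ) : block ξ v c z = (ξ z.1 + z.2 • v, c * z.2) := rfl

/-- The faithful affine representation of `IO(p,q)`: `(g, v)` acts on `ℝ^{p,q} × ℝ` by
`(x, s) ↦ (g x + s v, s)`. A map into `IO(p,q)` is smooth if and only if it is smooth as a map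
into endomorphisms. -/
def affine : IOpq p q →* AffEnd p q where
  toFun g := block g.right.val.val g.left.toAdd 1
  map_one' := by
    refine ContinuousLinearMap.ext fun z ↦ ?_
    simp
  map_mul' g h := by
    refine ContinuousLinearMap.ext fun z ↦ ?_
    have : (rotationAction p q g.right h.left).toAdd = g.right.val.val h.left.toAdd := rfl
    simp [this, add_comm, add_left_comm]

variable (p q)

/-- The Lie algebra `𝔦𝔬(p,q) = 𝔬(p,q) ⊕ ℝ^{p,q}` of `IO(p,q)`, in the affine representation:
`(ξ, v)` is the endomorphism `(x, s) ↦ (ξ x + s v, 0)`. -/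
def iopq : LieSubalgebra ℝ (AffEnd p q) where
  carrier := {X | ∃ ξ ∈ opq p q, ∃ v, X = block ξ v 0}
  zero_mem' := ⟨0, (opq p q).zero_mem, 0, by refine ContinuousLinearMap.ext fun z ↦ ?_; simp; rfl⟩
  add_mem' := by
    rintro _ _ ⟨ξ, hξ, v, rfl⟩ ⟨ζ, hζ, w, rfl⟩
    refine ⟨ξ + ζ, (opq p q).add_mem hξ hζ, v + w, ContinuousLinearMap.ext fun z ↦ ?_⟩
    simp [add_add_add_comm]
  smul_mem' := by
    rintro c _ ⟨ξ, hξ, v, rfl⟩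
    refine ⟨c • ξ, (opq p q).smul_mem c hξ, c • v, ContinuousLinearMap.ext fun z ↦ ?_⟩
    simp [smul_comm c]
  lie_mem' := by
    rintro _ _ ⟨ξ, hξ, v, rfl⟩ ⟨ζ, hζ, w, rfl⟩
    refine ⟨⁅ξ, ζ⁆, (opq p q).lie_mem hξ hζ, ξ w - ζ v, ContinuousLinearMap.ext fun z ↦ ?_⟩
    simp [LieRing.of_associative_ring_bracket, smul_sub, add_sub_add_comm]

/-! ### The teleparallel 2-group -/

/-- A crossed module `(G, H, t, α)`, the algebraic data equivalent to a strict 2-group: the group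
of objects is `G`, the group of morphisms is `H ⋊ G`, and `(h, g)` is a morphism from `g` to
`t h * g`. -/
structure CrossedModule (G H : Type*) [Group G] [Group H] where
  t : H →* G
  α : G →* MulAut H
  equivariant : ∀ g h, t (α g h) = g * t h * g⁻¹
  peiffer : ∀ h h', α (t h) h' = h * h' * h⁻¹

/-- The teleparallel 2-group `Tel(p,q)`, as a crossed module: `G = IO(p,q)`, `H = ℝ^{p,q}`,
`t v = (1, v)` and `α (g, v) w = g w`. -/
def Tel : CrossedModule (IOpq p q) (Multiplicative (Rpq p q)) where
  t := SemidirectProduct.inl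
  α := (rotationAction p q).comp SemidirectProduct.rightHom
  equivariant g h := by
    ext1
    · simp [mul_comm]
    · simp
  peiffer h h' := by simp

variable {p q}

/-- The action `α g` of `g ∈ IO(p,q)` on the Lie algebra `ℝ^{p,q}` of the vector group `H`. -/
def alpha (g : IOpq p q) (w : Rpq p q) : Rpq p q :=
  ((Tel p q).α g (Multiplicative.ofAdd w)).toAdd

/-- The differential of `t`: the inclusion `v ↦ (0, v)` of `ℝ^{p,q}` in `𝔦𝔬(p,q)`. -/
def tInf (v : Rpq p q) : AffEnd p q := block 0 v 0

/-- The differential of `α`: `(ξ, v) ∈ 𝔦𝔬(p,q)` acts on `ℝ^{p,q}` by `w ↦ ξ w`. -/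
def alphaInf (X : AffEnd p q) (w : Rpq p q) : Rpq p q := (X (w, 0)).1

theorem alphaInf_block (ξ : Rpq p q →L[ℝ] Rpq p q) (v w : Rpq p q) :
    alphaInf (block ξ v 0) w = ξ w := by
  simp [alphaInf]

/-- `tInf` is the derivative of `t` at the identity. -/
theorem hasDerivAt_t (v : Rpq p q) :
    HasDerivAt (fun s : ℝ ↦ affine ((Tel p q).t (Multiplicative.ofAdd (s • v)))) (tInf v) 0 := by
  have h : (fun s : ℝ ↦ affine ((Tel p q).t (Multiplicative.ofAdd (s • v)))) =
      fun s : ℝ ↦ 1 + s • tInf v := by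
    funext s
    refine ContinuousLinearMap.ext fun ⟨x, r⟩ ↦ ?_
    simp [affine, Tel, tInf, smul_comm s]
  rw [h]
  simpa using ((hasDerivAt_id (0 : ℝ)).smul_const (tInf v)).const_add (1 : AffEnd p q)

/-- `alphaInf` is the derivative of `α` along curves in `IO(p,q)`. -/
theorem hasDerivAt_alpha (c : ℝ → IOpq p q) (X : AffEnd p q)
    (h : HasDerivAt (fun s ↦ affine (c s)) X 0) (w : Rpq p q) :
    HasDerivAt (fun s ↦ alpha (c s) w) (alphaInf X w) 0 := by
  have e : (fun s ↦ alpha (c s) w) = fun s ↦ (affine (c s) (w, 0)).1 := by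
    funext s
    change (c s).right.val.val w = (block (c s).right.val.val (c s).left.toAdd 1 (w, 0)).1
    rw [block_apply]
    simp
  rw [e]
  let L : AffEnd p q →L[ℝ] Rpq p q :=
    (ContinuousLinearMap.fst ℝ (Rpq p q) ℝ).comp
      (ContinuousLinearMap.apply ℝ (Rpq p q × ℝ) ((w, 0) : Rpq p q × ℝ))
  exact L.hasFDerivAt.comp_hasDerivAt (0 : ℝ) h

/-! ### 2-connections and weak gauge transformations on the trivial `Tel(p,q)` 2-bundle -/

section Gauge

variable (p q) (E : Type*) [NormedAddCommGroup E] [NormedSpace ℝ E]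
  (M : Type*) [TopologicalSpace M] [ChartedSpace E M]

/-- A 2-connection on the trivial principal `Tel(p,q)` 2-bundle over `M`: a smooth
`𝔦𝔬(p,q)`-valued 1-form `A` and a smooth `ℝ^{p,q}`-valued 2-form `B` with vanishing fake curvature,
`dA + A ∧ A = t(B)`, where `(A ∧ A) (u, v) = ½ [A, A] (u, v) = [A u, A v]`. -/
structure TwoConnection where
  A : DiffForm E M (AffEnd p q) 1
  B : DiffForm E M (Rpq p q) 2
  smooth_A : A.Smooth
  smooth_B : B.Smooth
  A_mem : ∀ (x : M) (u : TangentSpace 𝓘(ℝ, E) x), A x ![u] ∈ iopq p q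
  fake_flat : ∀ (x : M) (u v : TangentSpace 𝓘(ℝ, E) x),
    A.d x ![u, v] + ⁅A x ![u], A x ![v]⁆ = tInf (B x ![u, v])

/-- A weak gauge transformation of the trivial `Tel(p,q)` 2-bundle over `M`: a smooth map
`g : M → IO(p,q)` together with a smooth `ℝ^{p,q}`-valued 1-form `a`. -/
structure WeakGaugeTransformation where
  g : M → IOpq p q
  a : DiffForm E M (Rpq p q) 1
  smooth_g : ContMDiff 𝓘(ℝ, E) 𝓘(ℝ, AffEnd p q) ∞ (fun x ↦ affine (g x))
  smooth_a : a.Smooth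

variable {p q E M}

/-- The value at `(u, v)` of the exterior covariant derivative `d_A a = da + α(A) ∧ a`. -/
def covariantD (A : DiffForm E M (AffEnd p q) 1) (a : DiffForm E M (Rpq p q) 1) (x : M)
    (u v : TangentSpace 𝓘(ℝ, E) x) : Rpq p q :=
  a.d x ![u, v] + (alphaInf (A x ![u]) (a x ![v]) - alphaInf (A x ![v]) (a x ![u]))

/-- The weak gauge transformation `(g, a)` takes the 2-connection `(A, B)` to `(A', B')`:
* `A' = g A g⁻¹ + g d(g⁻¹) + t(a)`,
* `B' = α(g)(B) + d_{A'} a + a ∧ a`, where `(a ∧ a) (u, v) = [a u, a v]`. -/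
structure WeakGaugeTransformation.Maps (T : WeakGaugeTransformation p q E M)
    (C C' : TwoConnection p q E M) : Prop where
  A_eq : ∀ (x : M) (u : TangentSpace 𝓘(ℝ, E) x),
    C'.A x ![u] = affine (T.g x) * C.A x ![u] * affine (T.g x)⁻¹ +
      affine (T.g x) * mvfderiv 𝓘(ℝ, E) (fun y ↦ affine (T.g y)⁻¹) x u +
      tInf (T.a x ![u])
  B_eq : ∀ (x : M) (u v : TangentSpace 𝓘(ℝ, E) x),
    C'.B x ![u, v] = alpha (T.g x) (C.B x ![u, v]) + covariantD C'.A T.a x u v +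
      ⁅T.a x ![u], T.a x ![v]⁆

end Gauge

end Teleparallel

end

/-! ### Covering spaces and locally constant cocycles. -/

section Topology

open Topology Filter Set

/-! Write `A = (ω, e)` with `ω` valued in `𝔬(p,q)` and `e` in `ℝ^{p,q}`. Since `t(B)` has no linear
part, fake flatness splits into two equations: `dω + ω ∧ ω = 0`, so `ω` is a flat connection
(`flat_coordLin`), and `B = de + ω ∧ e`, so `B` is the torsion determined by `A` (`B_inChart_eq`).

A flat `ω` has local frames `F` with `dF = -ω F`, obtained by parallel transport along radial
segments in a chart (`exists_local_parallel_frame`). Flatness makes transport to nearby endpoints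
agree to first order with the connection; this is the estimate `norm_transport_sub_le`. Because `ω`
is skew, the metric products of parallel frames are locally constant (`metric_parallel_eq`), so the
frames may be taken in `O(p,q)` and two of them differ by a locally constant right factor. These
factors define a covering of `M` with discrete fibre; trivial fundamental groups give it a section,
which glues the local frames to a global one (`exists_global_of_locallyConstant_cocycle`,
`exists_parallel`). `M` need not be connected.

Given global frames `F`, `F'` for the two 2-connections, put `Λ = F' F⁻¹`. Then `dΛ = Λ ω - ω' Λ`,
which says that `Λ` carries `ω` to `ω'`. Taking `g = (Λ, 0)` and `a = e' - Λ e` corrects the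
translation part, and the equation for `B'` follows because both 2-forms are torsions
(`exists_gaugeTransformation_of_parallel`). -/

/-- If all fundamental groups of `X` are trivial then every path component is simply connected. -/
theorem isSimplyConnected_pathComponent {X : Type*} [TopologicalSpace X]
    (hX : ∀ x : X, Subsingleton (FundamentalGroup X x)) (b : X) :
    IsSimplyConnected (pathComponent b) := by
  refine simply_connected_iff_loops_nullhomotopic.2
    ⟨isPathConnected_iff_pathConnectedSpace.1 isPathConnected_pathComponent, fun x γ ↦ ?_⟩
  have h : Path.Homotopic (γ.map continuous_subtype_val) (Path.refl x.1) :=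
    Quotient.exact ((hX x.1).elim (Path.Homotopic.Quotient.mk (γ.map continuous_subtype_val))
      (Path.Homotopic.Quotient.mk (Path.refl x.1)))
  obtain ⟨H⟩ := h
  -- The square is path connected and `H` passes through `x`, so the homotopy never leaves the path
  -- component and can be corestricted to it.
  have hmem : ∀ z, H z ∈ pathComponent b := fun z ↦ by
    have hr : IsPathConnected (range H) := by
      have : PathConnectedSpace unitInterval := isPathConnected_iff_pathConnectedSpace.1
        ((convex_Icc (0 : ℝ) 1).isPathConnected ⟨0, by simp⟩)
      rw [← image_univ, ← univ_prod_univ]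
      exact (isPathConnected_univ.prod isPathConnected_univ).image H.continuous
    have h0 : x.1 ∈ range H := ⟨(0, 0), by simp⟩
    exact (pathComponent_congr x.2).subset (hr.subset_pathComponent h0 ⟨z, rfl⟩)
  refine ⟨{ toFun := fun z ↦ ⟨H z, hmem z⟩
            continuous_toFun := H.continuous.subtype_mk _
            map_zero_left := fun t ↦ Subtype.ext (by simp)
            map_one_left := fun t ↦ Subtype.ext (by simp)
            prop' := fun t s hs ↦ Subtype.ext ?_ }⟩
  exact H.prop' t s hs

/-- A surjective covering of a locally path connected space with trivial fundamental groups has a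
continuous section. -/
theorem IsCoveringMap.exists_continuous_section {Y X : Type*} [TopologicalSpace Y]
    [TopologicalSpace X] [LocallyPathConnectedSpace X] {p : Y → X} (cov : IsCoveringMap p)
    (hp : Function.Surjective p) (hX : ∀ x : X, Subsingleton (FundamentalGroup X x)) :
    ∃ s : X → Y, Continuous s ∧ ∀ x, p (s x) = x := by
  -- Path components are open, hence locally path connected, and simply connected, so the lifting
  -- criterion applies to their inclusion into `X`.
  have key : ∀ b : X, ∃ F : C(pathComponent b, Y), ∀ x, p (F x) = x := fun b ↦ by
    have : SimplyConnectedSpace (pathComponent b) :=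
      (isSimplyConnected_pathComponent hX b).simplyConnectedSpace
    have : LocallyPathConnectedSpace (pathComponent b) :=
      (IsOpen.pathComponent b).locallyPathConnectedSpace
    obtain ⟨e, he⟩ := hp b
    obtain ⟨F, ⟨-, hF⟩, -⟩ := cov.existsUnique_continuousMap_lifts
      (⟨Subtype.val, continuous_subtype_val⟩ : C(pathComponent b, X))
      ⟨b, mem_pathComponent_self b⟩ e he
    exact ⟨F, fun x ↦ congr_fun hF x⟩
  choose F hF using key
  -- One base point per component, so that the sections chosen on the components combine to a
  -- function that is continuous on each of them.
  let rep : X → X := fun x ↦ (Quotient.mk (pathSetoid X) x).out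
  have hrep : ∀ x, x ∈ pathComponent (rep x) := fun x ↦
    Quotient.exact (Quotient.out_eq (Quotient.mk (pathSetoid X) x))
  have hrep' : ∀ x y, y ∈ pathComponent (rep x) → rep y = rep x := fun x y h ↦ by
    have : Quotient.mk (pathSetoid X) y = Quotient.mk (pathSetoid X) x :=
      Quotient.sound (Joined.trans (Joined.symm h) (hrep x))
    simp only [rep, this]
  refine ⟨fun x ↦ F (rep x) ⟨x, hrep x⟩, continuous_iff_continuousAt.2 fun x ↦ ?_,
    fun x ↦ hF _ _⟩
  have ho : IsOpen (pathComponent (rep x)) := IsOpen.pathComponent _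
  refine ContinuousOn.continuousAt (s := pathComponent (rep x)) ?_ (ho.mem_nhds (hrep x))
  rw [continuousOn_iff_continuous_domRestrict]
  convert! (F (rep x)).continuous using 1
  funext y
  -- The domain of `F c` depends on `c`, so the equality of base points is eliminated with `c`
  -- generalised.
  have aux : ∀ (c : X) (hc : c = rep x) (h : y.1 ∈ pathComponent c),
      F c ⟨y.1, h⟩ = F (rep x) y := by
    rintro _ rfl h; rfl
  exact aux _ (hrep' x y.1 y.2) _

/-- On a locally path connected space with trivial fundamental groups, every locally constant
cocycle is a coboundary, in the following form: functions given on an open cover that differ by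
locally constant factors can be multiplied by locally constant factors so as to agree. -/
theorem exists_global_of_locallyConstant_cocycle {X ι G : Type*} [TopologicalSpace X]
    [LocallyPathConnectedSpace X] [Group G] (hX : ∀ x : X, Subsingleton (FundamentalGroup X x))
    (U : ι → Set X) (hU : ∀ i, IsOpen (U i)) (hcov : ∀ x, ∃ i, x ∈ U i) (f : ι → X → G)
    (hf : ∀ i j, ∀ x ∈ U i ∩ U j, ∀ᶠ y in 𝓝 x, (f i y)⁻¹ * f j y = (f i x)⁻¹ * f j x) :
    ∃ F : X → G, ∀ i, ∀ x ∈ U i, ∀ᶠ y in 𝓝 x, (f i y)⁻¹ * F y = (f i x)⁻¹ * F x := by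
  -- With the discrete topology, locally constant transition functions are continuous and the
  -- resulting bundle is a covering.
  let _ : TopologicalSpace G := ⊥
  have : DiscreteTopology G := ⟨rfl⟩
  choose idx hidx using hcov
  let Z : FiberBundleCore ι X G :=
    { baseSet := U
      isOpen_baseSet := hU
      indexAt := idx
      mem_baseSet_at := hidx
      -- The coordinate `c` in chart `i` stands for the element `f i x * c`, which does not depend
      -- on the chart.
      coordChange := fun i j x c ↦ (f j x)⁻¹ * f i x * c
      coordChange_self := fun i x _ v ↦ by simp
      continuousOn_coordChange := fun i j ↦ by
        rintro ⟨x, c⟩ ⟨hx, -⟩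
        refine ContinuousAt.continuousWithinAt ?_
        have h1 : ContinuousAt (fun y ↦ (f j y)⁻¹ * f i y) x :=
          continuousAt_const.congr (EventuallyEq.symm (hf j i x hx.symm))
        have h2 : ContinuousAt (fun z : X × G ↦ (f j z.1)⁻¹ * f i z.1) (x, c) :=
          ContinuousAt.comp (f := Prod.fst) (x := (x, c)) h1 continuousAt_fst
        exact h2.mul continuousAt_snd
      coordChange_comp := fun i j k x _ v ↦ by group }
  have cov : IsCoveringMap (Bundle.TotalSpace.proj : Bundle.TotalSpace G Z.Fiber → X) :=
    FiberBundle.isCoveringMap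
  obtain ⟨s, hs, hps⟩ := cov.exists_continuous_section (fun x ↦ ⟨⟨x, (1 : G)⟩, rfl⟩) hX
  let c : X → G := fun x ↦ (s x).2
  -- This is the group element that the section represents. Its coordinate in chart `i` is `(f i)⁻¹
  -- * F`, continuous into a discrete space and therefore locally constant.
  refine ⟨fun x ↦ f (idx x) x * c x, fun i x hx ↦ ?_⟩
  have hmem : s x ∈ (Z.localTriv i).source := by
    rw [Z.mem_localTriv_source]
    exact (hps x).symm ▸ hx
  have h1 : ContinuousAt (fun y ↦ ((Z.localTriv i) (s y)).2) x :=
    (((Z.localTriv i).continuousOn.continuousAt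
      ((Z.localTriv i).open_source.mem_nhds hmem)).comp hs.continuousAt).snd
  have h2 : ∀ᶠ y in 𝓝 x, ((Z.localTriv i) (s y)).2 = ((Z.localTriv i) (s x)).2 :=
    h1.eventually (p := fun c ↦ c = ((Z.localTriv i) (s x)).2) (by simp [nhds_discrete])
  have h3 : ∀ y, ((Z.localTriv i) (s y)).2 = (f i y)⁻¹ * (f (idx y) y * c y) := fun y ↦ by
    rw [Z.localTriv_apply, ← mul_assoc]
    change (f i (s y).proj)⁻¹ * f (idx (s y).proj) (s y).proj * c y = _
    rw [hps y]
  filter_upwards [h2] with y hy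
  rw [← h3, ← h3, hy]

end Topology

/-! ### Parallel transport along segments: existence and estimates. -/

section FlatConnection

open Topology Filter Set Metric

variable {E : Type*} [NormedAddCommGroup E] [NormedSpace ℝ E]
  {R : Type*} [NormedRing R] [NormedAlgebra ℝ R]

/-- The linear equation `α' = -a α` on `[0, 1]`, with small coefficient `a`, has a solution. -/
theorem exists_linear_ode_solution [CompleteSpace R] {a : ℝ → R} {c : ℝ}
    (ha : ContinuousOn a (Icc 0 1)) (hc : ∀ t ∈ Icc (0 : ℝ) 1, ‖a t‖ ≤ c)
    (hc1 : c * (‖(1 : R)‖ + 1) ≤ 1) :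
    ∃ α : ℝ → R, α 0 = 1 ∧
      ∀ t ∈ Icc (0 : ℝ) 1, HasDerivWithinAt α (-(a t * α t)) (Icc 0 1) t := by
  have hc0 : 0 ≤ c := (norm_nonneg _).trans (hc 0 (by simp))
  -- On the unit ball around `1` the right-hand side is bounded by `c * (‖1‖ + 1) ≤ 1`, so a
  -- solution stays in that ball for unit time. The norm of `1` is not assumed to be `1`.
  have hpl : IsPicardLindelof (fun t x ↦ -(a t * x)) (⟨0, by simp⟩ : Icc (0 : ℝ) 1) (1 : R)
      1 0 1 ⟨c, hc0⟩ := by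
    refine ⟨fun t ht ↦ ?_, fun x _ ↦ (ha.mul continuousOn_const).neg, fun t ht x hx ↦ ?_, ?_⟩
    · refine LipschitzOnWith.of_dist_le_mul fun x _ y _ ↦ ?_
      rw [dist_neg_neg, dist_eq_norm, dist_eq_norm, ← mul_sub]
      exact (norm_mul_le _ _).trans (mul_le_mul_of_nonneg_right (hc t ht) (norm_nonneg _))
    · have hx' : ‖x‖ ≤ ‖(1 : R)‖ + 1 := by
        have h1 : ‖x - 1‖ ≤ 1 := by simpa [dist_eq_norm] using hx
        have := norm_le_insert' x 1
        linarith
      rw [norm_neg]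
      refine (norm_mul_le _ _).trans (le_trans ?_ hc1)
      exact mul_le_mul (hc t ht) hx' (norm_nonneg _) hc0
    · simp
  exact hpl.exists_eq_forall_mem_Icc_hasDerivWithinAt₀

/-- Grönwall's inequality without inhomogeneous term. The bound depends on the solution only through
`c` and supplies the constant `N` of `norm_transport_sub_le`. -/
theorem norm_le_exp_of_linear_ode {a α : ℝ → R} {c : ℝ}
    (hc : ∀ t ∈ Icc (0 : ℝ) 1, ‖a t‖ ≤ c) (h0 : α 0 = 1)
    (hα : ∀ t ∈ Icc (0 : ℝ) 1, HasDerivWithinAt α (-(a t * α t)) (Icc 0 1) t) :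
    ∀ t ∈ Icc (0 : ℝ) 1, ‖α t‖ ≤ ‖(1 : R)‖ * Real.exp c := by
  have hc0 : 0 ≤ c := (norm_nonneg _).trans (hc 0 (by simp))
  intro t ht
  have := norm_le_gronwallBound_of_norm_deriv_right_le (f := α) (δ := ‖(1 : R)‖) (K := c) (ε := 0)
    (fun t ht ↦ (hα t ht).continuousWithinAt)
    (fun t ht ↦ (hα t (Ico_subset_Icc_self ht)).mono_of_mem_nhdsWithin (Icc_mem_nhdsGE_of_mem ht))
    (by rw [h0]) (fun t ht ↦ by
      rw [norm_neg, add_zero]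
      exact (norm_mul_le _ _).trans
        (mul_le_mul_of_nonneg_right (hc t (Ico_subset_Icc_self ht)) (norm_nonneg _))) t ht
  rw [gronwallBound_ε0] at this
  refine this.trans (mul_le_mul_of_nonneg_left (Real.exp_le_exp.2 ?_) (norm_nonneg _))
  rw [sub_zero]
  exact mul_le_of_le_one_right hc0 ht.2

/-- Parallel transport along the segments from `x₀` to `y` and `y + h`, for a flat connection `Ω`,
compared up to second order in `h`. -/
theorem norm_transport_sub_le {Ω : E → E →L[ℝ] R} {x₀ : E} {r C N : ℝ} (hC : 1 ≤ C) (hr : r ≤ 1)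
    (hd : ∀ z ∈ ball x₀ r, DifferentiableAt ℝ Ω z)
    (hΩ : ∀ z ∈ ball x₀ r, ‖Ω z‖ ≤ C) (hD : ∀ z ∈ ball x₀ r, ‖fderiv ℝ Ω z‖ ≤ C)
    (hR : ∀ z ∈ ball x₀ r, ∀ z' ∈ ball x₀ r, ‖Ω z' - Ω z - fderiv ℝ Ω z (z' - z)‖ ≤ C * ‖z' - z‖ ^ 2)
    (flat : ∀ z ∈ ball x₀ r, ∀ u v, fderiv ℝ Ω z u v - fderiv ℝ Ω z v u +
      (Ω z u * Ω z v - Ω z v * Ω z u) = 0)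
    {y h : E} (hy : y ∈ ball x₀ r) (hyh : y + h ∈ ball x₀ r) (hh : ‖h‖ ≤ 1) {f k : ℝ → R}
    (hf0 : f 0 = 1) (hk0 : k 0 = 1) (hfN : ∀ t ∈ Icc (0 : ℝ) 1, ‖f t‖ ≤ N)
    (hf : ∀ t ∈ Icc (0 : ℝ) 1,
      HasDerivWithinAt f (-(Ω (x₀ + t • (y - x₀)) (y - x₀) * f t)) (Icc 0 1) t)
    (hk : ∀ t ∈ Icc (0 : ℝ) 1,
      HasDerivWithinAt k (-(Ω (x₀ + t • (y + h - x₀)) (y + h - x₀) * k t)) (Icc 0 1) t) :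
    ‖k 1 - (f 1 - Ω y h * f 1)‖ ≤ 6 * C ^ 2 * N * ‖h‖ ^ 2 / C * (Real.exp C - 1) := by
  have hN : 0 ≤ N := (norm_nonneg _).trans (hfN 0 (by simp))
  have hC0 : 0 ≤ C := zero_le_one.trans hC
  have hmem : ∀ {z}, z ∈ ball x₀ r → ∀ t ∈ Icc (0 : ℝ) 1, x₀ + t • (z - x₀) ∈ ball x₀ r := by
    intro z hz t ht
    rw [mem_ball, dist_eq_norm] at hz ⊢
    rw [add_sub_cancel_left, norm_smul, Real.norm_of_nonneg ht.1]
    exact (mul_le_of_le_one_left (norm_nonneg _) ht.2).trans_lt hz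
  have hnorm : ∀ {z}, z ∈ ball x₀ r → ‖z - x₀‖ ≤ 1 := fun {z} hz ↦ by
    rw [mem_ball, dist_eq_norm] at hz
    exact hz.le.trans hr
  set w := y - x₀ with hw
  have hw' : y + h - x₀ = w + h := by rw [hw]; abel
  have hwn : ‖w‖ ≤ 1 := hnorm hy
  have hwhn : ‖w + h‖ ≤ 1 := hw' ▸ hnorm hyh
  rw [hw'] at hk
  let γ : ℝ → E := fun t ↦ x₀ + t • w
  let η : ℝ → E := fun t ↦ x₀ + t • (w + h)
  have hγ : ∀ t ∈ Icc (0 : ℝ) 1, γ t ∈ ball x₀ r := hmem hy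
  have hη : ∀ t ∈ Icc (0 : ℝ) 1, η t ∈ ball x₀ r := by
    have := hmem hyh
    rwa [hw'] at this
  have hηγ : ∀ t, η t - γ t = t • h := fun t ↦ by simp only [η, γ]; module
  -- At time `t` the two segments differ by `t • h`, so the expected first variation of the frame is
  -- `-t Ω(γ t) h f`. The error `g` vanishes at `0`, and its value at `1` is the quantity to bound.
  let g : ℝ → R := fun t ↦ k t - (f t - t • (Ω (γ t) h * f t))
  let g' : ℝ → R := fun t ↦ -(Ω (η t) (w + h) * k t) - (-(Ω (γ t) w * f t) -
    (t • (Ω (γ t) h * (-(Ω (γ t) w * f t)) + fderiv ℝ Ω (γ t) w h * f t)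
      + (1 : ℝ) • (Ω (γ t) h * f t)))
  have hg : ∀ t ∈ Icc (0 : ℝ) 1, HasDerivWithinAt g (g' t) (Icc 0 1) t := by
    intro t ht
    have h1 : HasDerivWithinAt γ w (Icc 0 1) t := by
      have := (((hasDerivAt_id t).smul_const w).const_add x₀).hasDerivWithinAt (s := Icc 0 1)
      rw [one_smul] at this
      exact this
    have h2 : HasDerivWithinAt (fun s ↦ Ω (γ s)) (fderiv ℝ Ω (γ t) w) (Icc 0 1) t :=
      (hd _ (hγ t ht)).hasFDerivAt.comp_hasDerivWithinAt t h1
    have h3 : HasDerivWithinAt (fun s ↦ Ω (γ s) h) (fderiv ℝ Ω (γ t) w h) (Icc 0 1) t :=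
      (ContinuousLinearMap.apply ℝ R h).hasFDerivAt.comp_hasDerivWithinAt t h2
    have h4 := (hasDerivAt_id t).hasDerivWithinAt.fun_smul (h3.fun_mul (hf t ht))
    convert! (hk t ht).fun_sub ((hf t ht).fun_sub h4) using 1
    simp only [g', id]
    congr 3
    rw [add_comm (Ω (γ t) h * _)]
  have key : ∀ t ∈ Icc (0 : ℝ) 1, ‖g' t‖ ≤ C * ‖g t‖ + 6 * C ^ 2 * N * ‖h‖ ^ 2 := by
    intro t ht
    -- `S` is the remainder of the first-order expansion of `Ω` at `γ t`, evaluated on `w + h`; it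
    -- is quadratic in `h`.
    obtain ⟨S, hS⟩ : ∃ S, Ω (η t) (w + h) = Ω (γ t) w + Ω (γ t) h +
      t • (fderiv ℝ Ω (γ t) h w + fderiv ℝ Ω (γ t) h h) + S := ⟨_, (add_sub_cancel _ _).symm⟩
    have hSn : ‖S‖ ≤ C * ‖h‖ ^ 2 := by
      have e : S = (Ω (η t) - Ω (γ t) - fderiv ℝ Ω (γ t) (η t - γ t)) (w + h) := by
        rw [hηγ, sub_apply, sub_apply, hS, map_smul, smul_apply, map_add, map_add]
        module
      have h1 := hR _ (hγ t ht) _ (hη t ht)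
      have ht2 : ‖η t - γ t‖ ^ 2 ≤ ‖h‖ ^ 2 := by
        rw [hηγ, norm_smul, Real.norm_of_nonneg ht.1]
        have := mul_le_of_le_one_left (norm_nonneg h) ht.2
        have h0 : 0 ≤ t * ‖h‖ := mul_nonneg ht.1 (norm_nonneg _)
        gcongr
      rw [e]
      calc _ ≤ C * ‖η t - γ t‖ ^ 2 * 1 := (ContinuousLinearMap.le_opNorm _ _).trans
            (mul_le_mul h1 hwhn (norm_nonneg _) (by positivity))
        _ ≤ C * ‖h‖ ^ 2 := by rw [mul_one]; gcongr
    set Ow := Ω (γ t) w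
    set Oh := Ω (γ t) h
    set Dhw := fderiv ℝ Ω (γ t) h w
    set Dhh := fderiv ℝ Ω (γ t) h h
    -- Flatness enters only here: it trades the derivative along the segment for the derivative in
    -- direction `h` plus a commutator, and this cancels all terms of first order in `h`.
    have hfl : fderiv ℝ Ω (γ t) w h = Dhw + (Oh * Ow - Ow * Oh) := by
      have := flat _ (hγ t ht) h w
      rw [sub_add_eq_add_sub, sub_eq_zero] at this
      exact this.symm
    have hOh : ‖Oh‖ ≤ C * ‖h‖ := (Ω (γ t)).le_of_opNorm_le (hΩ _ (hγ t ht)) h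
    have hDh : ‖fderiv ℝ Ω (γ t) h‖ ≤ C * ‖h‖ :=
      (fderiv ℝ Ω (γ t)).le_of_opNorm_le (hD _ (hγ t ht)) h
    have hDhh : ‖Dhh‖ ≤ C * ‖h‖ ^ 2 :=
      ((fderiv ℝ Ω (γ t) h).le_of_opNorm_le hDh h).trans_eq (by ring)
    have hDhw : ‖Dhw‖ ≤ C * ‖h‖ := ((fderiv ℝ Ω (γ t) h).le_of_opNorm_le hDh w).trans
      (mul_le_of_le_one_right (by positivity) hwn)
    -- A linear equation for `g` with a source of six terms, each bounded by `C ^ 2 * ‖h‖ ^ 2`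
    -- before multiplication by `f t`; hence the factor `6`.
    have e : g' t = -(Ω (η t) (w + h) * g t) - (t • Dhh + S - t • (Oh * Oh)
        - (t * t) • (Dhw * Oh) - (t * t) • (Dhh * Oh) - t • (S * Oh)) * f t := by
      simp only [g', g, hS, hfl]
      simp only [add_mul, mul_sub, sub_mul, smul_mul_assoc, mul_smul_comm, mul_neg, smul_add, smul_sub, smul_neg, smul_smul, mul_assoc]
      module
    have hp : ∀ {c : ℝ} {z : R} {b : ℝ}, 0 ≤ c → c ≤ 1 → ‖z‖ ≤ b → ‖c • z‖ ≤ b := by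
      intro c z b h0 h1 hz
      rw [norm_smul, Real.norm_of_nonneg h0]
      exact (mul_le_of_le_one_left (norm_nonneg _) h1).trans hz
    have hm : ∀ {x z : R} {b d : ℝ}, ‖x‖ ≤ b → ‖z‖ ≤ d → ‖x * z‖ ≤ b * d := fun hx hz ↦
      (norm_mul_le _ _).trans (mul_le_mul hx hz (norm_nonneg _) ((norm_nonneg _).trans hx))
    have htt : 0 ≤ t * t := mul_self_nonneg t
    have htt1 : t * t ≤ 1 := mul_le_one₀ ht.2 ht.1 ht.2
    have hCh : C * ‖h‖ ^ 2 ≤ C ^ 2 * ‖h‖ ^ 2 := by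
      have : C ≤ C ^ 2 := by nlinarith
      gcongr
    have hCh3 : C * ‖h‖ ^ 2 * (C * ‖h‖) ≤ C ^ 2 * ‖h‖ ^ 2 := by
      have : C * ‖h‖ ^ 2 * (C * ‖h‖) = C ^ 2 * ‖h‖ ^ 2 * ‖h‖ := by ring
      rw [this]
      exact mul_le_of_le_one_right (by positivity) hh
    have hCh2 : C * ‖h‖ * (C * ‖h‖) = C ^ 2 * ‖h‖ ^ 2 := by ring
    have b1 := hp ht.1 ht.2 (hDhh.trans hCh)
    have b2 := hSn.trans hCh
    have b3 := hp ht.1 ht.2 ((hm hOh hOh).trans_eq hCh2)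
    have b4 := hp htt htt1 ((hm hDhw hOh).trans_eq hCh2)
    have b5 := hp htt htt1 ((hm hDhh hOh).trans hCh3)
    have b6 := hp ht.1 ht.2 ((hm hSn hOh).trans hCh3)
    have b7 : ‖Ω (η t) (w + h)‖ ≤ C :=
      ((Ω (η t)).le_of_opNorm_le (hΩ _ (hη t ht)) _).trans (mul_le_of_le_one_right hC0 hwhn)
    rw [e]
    refine (norm_sub_le _ _).trans (add_le_add ?_ ?_)
    · rw [norm_neg]
      exact hm b7 le_rfl
    · refine (hm ?_ (hfN t ht)).trans_eq (?_ : (6 * (C ^ 2 * ‖h‖ ^ 2)) * N = _)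
      · have := norm_sub_le_of_le (norm_sub_le_of_le (norm_sub_le_of_le (norm_sub_le_of_le
          (norm_add_le_of_le b1 b2) b3) b4) b5) b6
        linarith
      · ring
  have hG := norm_le_gronwallBound_of_norm_deriv_right_le (f := g) (f' := g') (δ := 0) (K := C)
    (ε := 6 * C ^ 2 * N * ‖h‖ ^ 2)
    (fun t ht ↦ (hg t ht).continuousWithinAt)
    (fun t ht ↦ (hg t (Ico_subset_Icc_self ht)).mono_of_mem_nhdsWithin (Icc_mem_nhdsGE_of_mem ht))
    (by simp [g, hf0, hk0]) (fun t ht ↦ key t (Ico_subset_Icc_self ht)) 1 (by simp)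
  rw [gronwallBound_of_K_ne_0 (by positivity)] at hG
  simpa [g, γ, hw] using hG

end FlatConnection

/-! ### Local parallel frames and their regularity. -/

section FlatConnection

open Topology Filter Set Metric

variable {E : Type*} [NormedAddCommGroup E] [NormedSpace ℝ E]
  {R : Type*} [NormedRing R] [NormedAlgebra ℝ R]

/-- The right-hand side `h ↦ -Ω h * b` of the equation of parallel transport. -/
noncomputable def parallelDeriv (Ω : E →L[ℝ] R) (b : R) : E →L[ℝ] R :=
  -(((ContinuousLinearMap.mul ℝ R).flip b).comp Ω)

@[simp] theorem parallelDeriv_apply (Ω : E →L[ℝ] R) (b : R) (h : E) :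
    parallelDeriv Ω b h = -(Ω h * b) := rfl

/-- A flat connection has a local parallel frame. -/
theorem exists_local_parallel_frame [CompleteSpace R] {Ω : E → E →L[ℝ] R} {x₀ : E} {U : Set E}
    (hU : U ∈ 𝓝 x₀) (hΩ : ContDiffAt ℝ 2 Ω x₀)
    (flat : ∀ z ∈ U, ∀ u v, fderiv ℝ Ω z u v - fderiv ℝ Ω z v u +
      (Ω z u * Ω z v - Ω z v * Ω z u) = 0) :
    ∃ r > 0, ∃ f : E → R, ball x₀ r ⊆ U ∧ f x₀ = 1 ∧
      ∀ y ∈ ball x₀ r, HasFDerivAt f (parallelDeriv (Ω y) (f y)) y := by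
  have hD1 : ContDiffAt ℝ 1 (fderiv ℝ Ω) x₀ := hΩ.fderiv_right (by norm_num)
  obtain ⟨K, V, hV, hK⟩ := hD1.exists_lipschitzOnWith
  -- One constant that bounds `Ω` and its derivative near `x₀`, dominates the Lipschitz constant of
  -- the derivative, and is at least `1`.
  set C : ℝ := ‖Ω x₀‖ + ‖fderiv ℝ Ω x₀‖ + K + 1 with hCdef
  have hC : 1 ≤ C := by
    have := norm_nonneg (Ω x₀)
    have := norm_nonneg (fderiv ℝ Ω x₀)
    have := K.coe_nonneg
    linarith
  have hC0 : 0 < C := zero_lt_one.trans_le hC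
  have hK0 : (0 : ℝ) ≤ K := K.coe_nonneg
  have hΩC : ‖Ω x₀‖ < C := by
    have := norm_nonneg (fderiv ℝ Ω x₀)
    linarith
  have e1 : ∀ᶠ z in 𝓝 x₀, ‖Ω z‖ < C := hΩ.continuousAt.norm.eventually_lt continuousAt_const hΩC
  have e2 : ∀ᶠ z in 𝓝 x₀, ‖fderiv ℝ Ω z‖ < C := by
    filter_upwards [hV, ball_mem_nhds x₀ zero_lt_one] with z hz hz1
    have h1 := hK.dist_le_mul z hz x₀ (mem_of_mem_nhds hV)
    rw [dist_eq_norm] at h1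
    have h2 := norm_le_insert' (fderiv ℝ Ω z) (fderiv ℝ Ω x₀)
    have h3 : K * dist z x₀ ≤ K * 1 := mul_le_mul_of_nonneg_left (mem_ball.1 hz1).le hK0
    have := norm_nonneg (Ω x₀)
    linarith
  have e3 : ∀ᶠ z in 𝓝 x₀, ContDiffAt ℝ 2 Ω z := hΩ.eventually (by simp)
  obtain ⟨r₀, hr₀, hball⟩ := Metric.eventually_nhds_iff_ball.1
    (((e1.and e2).and e3).and (inter_mem hU hV))
  have hpos : 0 < C * (‖(1 : R)‖ + 1) := by positivity
  -- The last bound makes the coefficient `C * r` small enough for `exists_linear_ode_solution`; the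
  -- middle one gives the `r ≤ 1` needed in the transport estimate.
  set r := min r₀ (min (1 / 2) (1 / (C * (‖(1 : R)‖ + 1)))) with hrdef
  have hr : 0 < r := by positivity
  have hrr₀ : r ≤ r₀ := min_le_left _ _
  have hr2 : r ≤ 1 / 2 := (min_le_right _ _).trans (min_le_left _ _)
  have hrC : r ≤ 1 / (C * (‖(1 : R)‖ + 1)) := (min_le_right _ _).trans (min_le_right _ _)
  have hb : ∀ z ∈ ball x₀ r, ((‖Ω z‖ < C ∧ ‖fderiv ℝ Ω z‖ < C) ∧ ContDiffAt ℝ 2 Ω z) ∧ z ∈ U ∩ V :=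
    fun z hz ↦ hball z (ball_subset_ball hrr₀ hz)
  have hd : ∀ z ∈ ball x₀ r, DifferentiableAt ℝ Ω z := fun z hz ↦
    (hb z hz).1.2.differentiableAt (by norm_num)
  have hmem : ∀ {z}, z ∈ ball x₀ r → ∀ t ∈ Icc (0 : ℝ) 1, x₀ + t • (z - x₀) ∈ ball x₀ r := by
    intro z hz t ht
    rw [mem_ball, dist_eq_norm] at hz ⊢
    rw [add_sub_cancel_left, norm_smul, Real.norm_of_nonneg ht.1]
    exact (mul_le_of_le_one_left (norm_nonneg _) ht.2).trans_lt hz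
  have hcoef : ∀ z ∈ ball x₀ r, ∀ t ∈ Icc (0 : ℝ) 1,
      ‖Ω (x₀ + t • (z - x₀)) (z - x₀)‖ ≤ C * r := fun z hz t ht ↦ by
    refine ((Ω _).le_of_opNorm_le (hb _ (hmem hz t ht)).1.1.1.le _).trans ?_
    rw [mem_ball, dist_eq_norm] at hz
    gcongr
  have hex : ∀ z ∈ ball x₀ r, ∃ α : ℝ → R, α 0 = 1 ∧ ∀ t ∈ Icc (0 : ℝ) 1,
      HasDerivWithinAt α (-(Ω (x₀ + t • (z - x₀)) (z - x₀) * α t)) (Icc 0 1) t := by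
    intro z hz
    refine exists_linear_ode_solution (c := C * r) (fun t ht ↦ ?_) (hcoef z hz) ?_
    · refine ContinuousAt.continuousWithinAt ?_
      have h1 : ContinuousAt (fun t : ℝ ↦ Ω (x₀ + t • (z - x₀))) t :=
        ContinuousAt.comp (f := fun t : ℝ ↦ x₀ + t • (z - x₀))
          (hd _ (hmem hz t ht)).continuousAt (by fun_prop)
      exact h1.clm_apply continuousAt_const
    · rw [le_div_iff₀ hpos] at hrC
      linarith
  choose! α hα0 hα using hex
  -- The frame at `z` is the result of transport from `x₀` along the straight segment. At `x₀`
  -- itself the coefficient vanishes and transport is constant.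
  refine ⟨r, hr, fun z ↦ α z 1, fun z hz ↦ (hb z hz).2.1, ?_, fun y hy ↦ ?_⟩
  · have hx : x₀ ∈ ball x₀ r := mem_ball_self hr
    have := constant_of_derivWithin_zero (f := α x₀) (a := 0) (b := 1)
      (fun t ht ↦ (hα x₀ hx t ht).differentiableWithinAt) (fun t ht ↦ by
        have h := hα x₀ hx t (Ico_subset_Icc_self ht)
        rw [sub_self, map_zero, zero_mul, neg_zero] at h
        exact h.derivWithin (uniqueDiffOn_Icc zero_lt_one t (Ico_subset_Icc_self ht))) 1 (by simp)
    exact this.trans (hα0 _ hx)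
  · set N := ‖(1 : R)‖ * Real.exp (C * r)
    have hN := norm_le_exp_of_linear_ode (hcoef y hy) (hα0 y hy) (hα y hy)
    have hR : ∀ z ∈ ball x₀ r, ∀ z' ∈ ball x₀ r,
        ‖Ω z' - Ω z - fderiv ℝ Ω z (z' - z)‖ ≤ C * ‖z' - z‖ ^ 2 := by
      intro z hz z' hz'
      have hKC : (K : ℝ) ≤ C := by
        have := norm_nonneg (fderiv ℝ Ω x₀)
        have := norm_nonneg (Ω x₀)
        linarith
      have hseg : segment ℝ z z' ⊆ ball x₀ r := (convex_ball x₀ r).segment_subset hz hz'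
      -- Quadratic Taylor bound from the mean value inequality on the segment, since `fderiv ℝ Ω` is
      -- Lipschitz there.
      have := (convex_segment z z').norm_image_sub_le_of_norm_hasFDerivWithin_le'
        (f := Ω) (f' := fderiv ℝ Ω) (φ := fderiv ℝ Ω z) (C := C * ‖z' - z‖)
        (fun ξ hξ ↦ (hd ξ (hseg hξ)).hasFDerivAt.hasFDerivWithinAt) (fun ξ hξ ↦ by
          have h1 := hK.dist_le_mul ξ (hb ξ (hseg hξ)).2.2 z (hb z hz).2.2
          rw [dist_eq_norm, dist_eq_norm] at h1
          refine h1.trans ?_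
          gcongr
          exact norm_sub_le_of_mem_segment hξ)
        (left_mem_segment ℝ z z') (right_mem_segment ℝ z z')
      exact this.trans_eq (by ring)
    have hn : ∀ᶠ h in 𝓝 (0 : E), y + h ∈ ball x₀ r ∧ ‖h‖ ≤ 1 := by
      have h1 : Tendsto (fun h ↦ y + h) (𝓝 (0 : E)) (𝓝 y) := by
        have := (continuous_const_add y).tendsto 0
        rwa [add_zero] at this
      refine (h1.eventually (isOpen_ball.mem_nhds hy)).and ?_
      filter_upwards [closedBall_mem_nhds (0 : E) zero_lt_one] with h hh
      simpa using hh
    rw [hasFDerivAt_iff_isLittleO_nhds_zero]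
    refine Asymptotics.IsBigO.trans_isLittleO (g := fun h : E ↦ ‖h‖ ^ 2) ?_
      (Asymptotics.isLittleO_norm_pow_id one_lt_two)
    refine Asymptotics.IsBigO.of_bound (6 * C ^ 2 * N / C * (Real.exp C - 1)) ?_
    filter_upwards [hn] with h hh
    have hest := norm_transport_sub_le hC (hr2.trans (by norm_num)) hd
      (fun z hz ↦ (hb z hz).1.1.1.le) (fun z hz ↦ (hb z hz).1.1.2.le) hR
      (fun z hz ↦ flat z (hb z hz).2.1) hy hh.1 hh.2 (hα0 y hy) (hα0 _ hh.1) hN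
      (hα y hy) (hα _ hh.1)
    rw [parallelDeriv_apply, Real.norm_of_nonneg (by positivity)]
    refine (le_of_eq ?_).trans (hest.trans_eq ?_)
    · congr 1
      abel
    · ring

/-- Parallel frames are as smooth as the connection allows. -/
theorem contDiffOn_of_hasFDerivAt_parallel {Ω : E → E →L[ℝ] R} {f : E → R} {U : Set E}
    (hU : IsOpen U) (hΩ : ContDiffOn ℝ ∞ Ω U)
    (hf : ∀ y ∈ U, HasFDerivAt f (parallelDeriv (Ω y) (f y)) y) : ContDiffOn ℝ ∞ f U := by
  rw [contDiffOn_infty]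
  intro n
  -- Bootstrapping: if `f` is `C^n` then so is its derivative `-Ω f`, hence `f` is `C^(n+1)`.
  induction n with
  | zero =>
    exact contDiffOn_zero.2 fun y hy ↦ (hf y hy).continuousAt.continuousWithinAt
  | succ n ih =>
    have hω : (n : WithTop ℕ∞) ≠ ω := by simp
    refine (contDiffOn_succ_iff_fderiv_of_isOpen hU).2
      ⟨fun y hy ↦ (hf y hy).differentiableAt.differentiableWithinAt, fun h ↦ absurd h hω, ?_⟩
    have h1 : ContDiffOn ℝ n (fun y ↦ parallelDeriv (Ω y) (f y)) U := by
      refine ContDiffOn.neg (ContDiffOn.clm_comp ?_ (hΩ.of_le (by exact_mod_cast le_top)))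
      exact (ContinuousLinearMap.mul ℝ R).flip.contDiff.comp_contDiffOn ih
    exact h1.congr fun y hy ↦ (hf y hy).fderiv

end FlatConnection

/-! ### Coordinate expressions of forms and change of chart. -/

namespace Teleparallel

section Charts

open Topology Filter Set

variable {E : Type*} [NormedAddCommGroup E] [NormedSpace ℝ E]
  {M : Type*} [TopologicalSpace M] [ChartedSpace E M]
  {F : Type*} [NormedAddCommGroup F] [NormedSpace ℝ F]

section

variable [IsManifold 𝓘(ℝ, E) ∞ M]

theorem contMDiffAt_extChartAt_symm {x₁ : M} {y : E} (hy : y ∈ (extChartAt 𝓘(ℝ, E) x₁).target) :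
    ContMDiffAt 𝓘(ℝ, E) 𝓘(ℝ, E) ∞ (extChartAt 𝓘(ℝ, E) x₁).symm y :=
  (contMDiffOn_extChartAt_symm x₁).contMDiffAt ((isOpen_extChartAt_target x₁).mem_nhds hy)

theorem contMDiffAt_extChartAt_of_mem {x₀ x : M} (hx : x ∈ (extChartAt 𝓘(ℝ, E) x₀).source) :
    ContMDiffAt 𝓘(ℝ, E) 𝓘(ℝ, E) ∞ (extChartAt 𝓘(ℝ, E) x₀) x :=
  contMDiffAt_extChartAt' (by rwa [extChartAt_source] at hx)

theorem contDiffAt_extChartAt_comp_symm {x₀ x₁ : M} {y : E}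
    (hy : y ∈ (extChartAt 𝓘(ℝ, E) x₁).target)
    (hy' : (extChartAt 𝓘(ℝ, E) x₁).symm y ∈ (extChartAt 𝓘(ℝ, E) x₀).source) :
    ContDiffAt ℝ ∞ (extChartAt 𝓘(ℝ, E) x₀ ∘ (extChartAt 𝓘(ℝ, E) x₁).symm) y :=
  contMDiffAt_iff_contDiffAt.1
    ((contMDiffAt_extChartAt_of_mem hy').comp y (contMDiffAt_extChartAt_symm hy))

theorem eventually_symm_mem_source {x₀ x₁ : M} {y : E}
    (hy : y ∈ (extChartAt 𝓘(ℝ, E) x₁).target)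
    (hy' : (extChartAt 𝓘(ℝ, E) x₁).symm y ∈ (extChartAt 𝓘(ℝ, E) x₀).source) :
    ∀ᶠ z in 𝓝 y, z ∈ (extChartAt 𝓘(ℝ, E) x₁).target ∧
      (extChartAt 𝓘(ℝ, E) x₁).symm z ∈ (extChartAt 𝓘(ℝ, E) x₀).source :=
  Filter.Eventually.and ((isOpen_extChartAt_target x₁).mem_nhds hy)
    ((contMDiffAt_extChartAt_symm hy).continuousAt.eventually
      ((isOpen_extChartAt_source x₀).mem_nhds hy'))

/-- The chain rule applied to `φ₀⁻¹ ∘ (φ₀ ∘ φ₁⁻¹) = φ₁⁻¹`, valid near `y`. -/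
theorem mfderiv_symm_comp_fderiv {x₀ x₁ : M} {y : E}
    (hy : y ∈ (extChartAt 𝓘(ℝ, E) x₁).target)
    (hy' : (extChartAt 𝓘(ℝ, E) x₁).symm y ∈ (extChartAt 𝓘(ℝ, E) x₀).source) :
    ((mfderiv 𝓘(ℝ, E) 𝓘(ℝ, E) (extChartAt 𝓘(ℝ, E) x₀).symm
      (extChartAt 𝓘(ℝ, E) x₀ ((extChartAt 𝓘(ℝ, E) x₁).symm y)) : E →L[ℝ] E).comp
      (fderiv ℝ (extChartAt 𝓘(ℝ, E) x₀ ∘ (extChartAt 𝓘(ℝ, E) x₁).symm) y) : E →L[ℝ] E) =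
    mfderiv 𝓘(ℝ, E) 𝓘(ℝ, E) (extChartAt 𝓘(ℝ, E) x₁).symm y := by
  have h1 : (extChartAt 𝓘(ℝ, E) x₀).symm ∘ (extChartAt 𝓘(ℝ, E) x₀ ∘
      (extChartAt 𝓘(ℝ, E) x₁).symm) =ᶠ[𝓝 y] (extChartAt 𝓘(ℝ, E) x₁).symm := by
    filter_upwards [eventually_symm_mem_source hy hy'] with z hz
    exact (extChartAt 𝓘(ℝ, E) x₀).left_inv hz.2
  have h2 := h1.mfderiv_eq (I := 𝓘(ℝ, E)) (I' := 𝓘(ℝ, E))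
  have h3 : MDifferentiableAt 𝓘(ℝ, E) 𝓘(ℝ, E) (extChartAt 𝓘(ℝ, E) x₀).symm
      ((extChartAt 𝓘(ℝ, E) x₀ ∘ (extChartAt 𝓘(ℝ, E) x₁).symm) y) :=
    (contMDiffAt_extChartAt_symm
      ((extChartAt 𝓘(ℝ, E) x₀).map_source hy')).mdifferentiableAt (by simp)
  have h4 : DifferentiableAt ℝ (extChartAt 𝓘(ℝ, E) x₀ ∘ (extChartAt 𝓘(ℝ, E) x₁).symm) y :=
    (contDiffAt_extChartAt_comp_symm hy hy').differentiableAt (by simp)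
  exact (HasMFDerivAt.comp y h3.hasMFDerivAt h4.hasFDerivAt.hasMFDerivAt).mfderiv.symm.trans h2

end

/-- The type of `θ x` depends on `x`, which blocks rewriting of the base point; regarding all
tangent spaces as the model space `E` allows substitution. -/
theorem DiffForm.compContinuousLinearMap_congr {n : ℕ} (θ : DiffForm E M F n) {x x' : M}
    (h : x' = x) {D D' : E →L[ℝ] E} (hD : D' = D) :
    ((θ x' : E [⋀^Fin n]→L[ℝ] F).compContinuousLinearMap D' : E [⋀^Fin n]→L[ℝ] F) =
      (θ x : E [⋀^Fin n]→L[ℝ] F).compContinuousLinearMap D := by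
  subst h hD
  rfl

variable [IsManifold 𝓘(ℝ, E) ∞ M]

/-- The coordinate expressions of a form in two charts are related by pullback. -/
theorem DiffForm.inChart_eq_pullback {n : ℕ} (θ : DiffForm E M F n) {x₀ x₁ : M} {y : E}
    (hy : y ∈ (extChartAt 𝓘(ℝ, E) x₁).target)
    (hy' : (extChartAt 𝓘(ℝ, E) x₁).symm y ∈ (extChartAt 𝓘(ℝ, E) x₀).source) :
    θ.inChart x₁ y =
      (θ.inChart x₀ (extChartAt 𝓘(ℝ, E) x₀ ((extChartAt 𝓘(ℝ, E) x₁).symm y))).compContinuousLinearMap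
        (fderiv ℝ (extChartAt 𝓘(ℝ, E) x₀ ∘ (extChartAt 𝓘(ℝ, E) x₁).symm) y) :=
  (θ.compContinuousLinearMap_congr ((extChartAt 𝓘(ℝ, E) x₀).left_inv hy')
    (mfderiv_symm_comp_fderiv hy hy')).symm

omit [IsManifold 𝓘(ℝ, E) ∞ M] in
theorem DiffForm.Smooth.contDiffAt {n : ℕ} {θ : DiffForm E M F n} (hθ : θ.Smooth) {x₀ : M} {y : E}
    (hy : y ∈ (extChartAt 𝓘(ℝ, E) x₀).target) : ContDiffAt ℝ ∞ (θ.inChart x₀) y :=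
  (hθ x₀).contDiffAt ((isOpen_extChartAt_target x₀).mem_nhds hy)

/-- The exterior derivative is computed in any chart. -/
theorem DiffForm.Smooth.inChart_d {n : ℕ} {θ : DiffForm E M F n} (hθ : θ.Smooth) {x₁ : M} {y : E}
    (hy : y ∈ (extChartAt 𝓘(ℝ, E) x₁).target) :
    θ.d.inChart x₁ y = extDeriv (θ.inChart x₁) y := by
  set x := (extChartAt 𝓘(ℝ, E) x₁).symm y with hx
  have hy' : (extChartAt 𝓘(ℝ, E) x₁).symm y ∈ (extChartAt 𝓘(ℝ, E) x).source :=
    mem_extChartAt_source x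
  have h1 : θ.inChart x₁ =ᶠ[𝓝 y] fun z ↦
      (θ.inChart x ((extChartAt 𝓘(ℝ, E) x ∘ (extChartAt 𝓘(ℝ, E) x₁).symm) z)).compContinuousLinearMap
        (fderiv ℝ (extChartAt 𝓘(ℝ, E) x ∘ (extChartAt 𝓘(ℝ, E) x₁).symm) z) := by
    filter_upwards [eventually_symm_mem_source hy hy'] with z hz
    exact θ.inChart_eq_pullback hz.1 hz.2
  have h3 : DifferentiableAt ℝ (θ.inChart x)
      ((extChartAt 𝓘(ℝ, E) x ∘ (extChartAt 𝓘(ℝ, E) x₁).symm) y) :=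
    (hθ.contDiffAt (mem_extChartAt_target x)).differentiableAt (by simp)
  -- `d` at `x` is defined through the chart around `x`; naturality under the transition map, which
  -- must be `C^2`, moves it to the chart around `x₁`.
  rw [h1.extDeriv_eq, extDeriv_pullback h3 (contDiffAt_extChartAt_comp_symm hy hy') (by
    rw [minSmoothness_of_isRCLikeNormedField]
    exact WithTop.coe_le_coe.2 (le_top : (2 : ℕ∞) ≤ ⊤))]
  have h2 : fderiv ℝ (extChartAt 𝓘(ℝ, E) x ∘ (extChartAt 𝓘(ℝ, E) x₁).symm) y =
      ((mfderiv 𝓘(ℝ, E) 𝓘(ℝ, E) (extChartAt 𝓘(ℝ, E) x) x : E →L[ℝ] E).comp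
        (mfderiv 𝓘(ℝ, E) 𝓘(ℝ, E) (extChartAt 𝓘(ℝ, E) x₁).symm y : E →L[ℝ] E) : E →L[ℝ] E) := by
    refine HasFDerivAt.fderiv (HasMFDerivAt.hasFDerivAt ?_)
    exact HasMFDerivAt.comp y
      ((contMDiffAt_extChartAt_of_mem hy').mdifferentiableAt (by simp)).hasMFDerivAt
      ((contMDiffAt_extChartAt_symm hy).mdifferentiableAt (by simp)).hasMFDerivAt
  rw [h2]
  rfl

/-- At the centre of a chart the coordinate expression of a form is the form itself. -/
theorem DiffForm.inChart_self {n : ℕ} (θ : DiffForm E M F n) (x : M) :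
    θ.inChart x (extChartAt 𝓘(ℝ, E) x x) = θ x := by
  -- The tangent space at `x` is identified with `E` by the preferred chart at `x`, so that chart
  -- has identity derivative there.
  have h : mfderiv 𝓘(ℝ, E) 𝓘(ℝ, E) (extChartAt 𝓘(ℝ, E) x).symm (extChartAt 𝓘(ℝ, E) x x) =
      ContinuousLinearMap.id ℝ E := by
    have : IsManifold 𝓘(ℝ, E) 1 M := IsManifold.of_le (n := ∞) (by simp)
    have h := mfderivWithin_range_extChartAt_symm (I := 𝓘(ℝ, E)) (x := x)
    rw [modelWithCornersSelf_coe, range_id, mfderivWithin_univ] at h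
    exact h
  exact (θ.compContinuousLinearMap_congr (extChartAt_to_inv x) h).trans (by ext; rfl)

theorem DiffForm.Smooth.d_apply {n : ℕ} {θ : DiffForm E M F n} (hθ : θ.Smooth) (x : M) :
    θ.d x = extDeriv (θ.inChart x) (extChartAt 𝓘(ℝ, E) x x) := by
  rw [← hθ.inChart_d (mem_extChartAt_target x), DiffForm.inChart_self]

omit [IsManifold 𝓘(ℝ, E) ∞ M] in
theorem DiffForm.inChart_apply {n : ℕ} (θ : DiffForm E M F n) (x₀ : M) (y : E) (v : Fin n → E) :
    θ.inChart x₀ y v = θ ((extChartAt 𝓘(ℝ, E) x₀).symm y)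
      (fun i ↦ mfderiv 𝓘(ℝ, E) 𝓘(ℝ, E) (extChartAt 𝓘(ℝ, E) x₀).symm y (v i)) := rfl

end Charts

/-! ### One-forms as linear maps. -/

section OneForms

variable {E : Type*} [NormedAddCommGroup E] [NormedSpace ℝ E]
  {F : Type*} [NormedAddCommGroup F] [NormedSpace ℝ F]

/-- An alternating `1`-linear map, as a linear map. -/
noncomputable def oneFormCLM : (E [⋀^Fin 1]→L[ℝ] F) ≃L[ℝ] (E →L[ℝ] F) :=
  (ContinuousAlternatingMap.ofSubsingletonLIE (0 : Fin 1)).symm.toContinuousLinearEquiv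

theorem oneFormCLM_apply (θ : E [⋀^Fin 1]→L[ℝ] F) (u : E) : oneFormCLM θ u = θ ![u] := by
  have : ![u] = fun _ ↦ u := by
    ext i
    simp
  rw [this]
  rfl

/-- The exterior derivative alternates the derivative over the removed argument; for a 1-form this
leaves two terms of opposite sign. -/
theorem extDeriv_oneForm_apply {θ : E → E [⋀^Fin 1]→L[ℝ] F} {y : E} (u v : E) :
    extDeriv θ y ![u, v] = fderiv ℝ (fun z ↦ oneFormCLM (θ z)) y u v -
      fderiv ℝ (fun z ↦ oneFormCLM (θ z)) y v u := by
  have h : fderiv ℝ (fun z ↦ oneFormCLM (θ z)) y =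
      (oneFormCLM (E := E) (F := F) : _ →L[ℝ] _).comp (fderiv ℝ θ y) :=
    oneFormCLM.comp_fderiv (f := θ)
  rw [extDeriv, ContinuousAlternatingMap.alternatizeUncurryFin_apply, h, Fin.sum_univ_two]
  simp only [ContinuousLinearMap.comp_apply, ContinuousLinearEquiv.coe_coe, oneFormCLM_apply]
  have e1 : Fin.removeNth 0 ![u, v] = ![v] := by ext i; simp [Fin.removeNth]
  have e2 : Fin.removeNth 1 ![u, v] = ![u] := by ext i; simp [Fin.removeNth, Fin.eq_zero i]
  rw [e1, e2]
  simp [sub_eq_add_neg]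

end OneForms

end Teleparallel

/-! ### The metric and parallel frames with values in `O(p,q)`. -/

namespace Teleparallel

section Metric

variable {p q : ℕ}

/-- The metric of `ℝ^{p,q}` as a continuous bilinear map. -/
noncomputable def metricCLM (p q : ℕ) : Rpq p q →L[ℝ] Rpq p q →L[ℝ] ℝ :=
  LinearMap.toContinuousBilinearMap (LinearMap.mk₂ ℝ (metric p q)
    (fun x y z ↦ by simp only [metric, Pi.add_apply, add_mul, Finset.sum_add_distrib]; ring)
    (fun c x y ↦ by simp [metric, mul_sub, Finset.mul_sum, mul_assoc])
    (fun x y z ↦ by simp only [metric, Pi.add_apply, mul_add, Finset.sum_add_distrib]; ring)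
    (fun c x y ↦ by simp [metric, mul_sub, Finset.mul_sum, mul_left_comm]))

theorem metricCLM_apply (x y : Rpq p q) : metricCLM p q x y = metric p q x y := rfl

/-- Nondegeneracy: pairing with a standard basis vector reads off a coordinate up to sign. -/
theorem eq_of_metric_eq {x y : Rpq p q} (h : ∀ z, metric p q z x = metric p q z y) : x = y := by
  funext k
  have hk := h (Pi.single k 1)
  rcases k with i | j
  · simpa [metric, Pi.single_apply] using hk
  · simpa [metric, Pi.single_apply] using hk

/-- Nondegeneracy makes an isometry injective, hence invertible in finite dimension. -/
theorem exists_Opq_of_isometry {L : Rpq p q →L[ℝ] Rpq p q}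
    (hL : ∀ x y, metric p q (L x) (L y) = metric p q x y) : ∃ g : Opq p q, g.val.val = L := by
  have hinj : Function.Injective L := fun x y hxy ↦
    eq_of_metric_eq fun z ↦ by rw [← hL, ← hL z y, hxy]
  let e : Rpq p q ≃L[ℝ] Rpq p q :=
    (LinearEquiv.ofInjectiveEndo (L : Rpq p q →ₗ[ℝ] Rpq p q) hinj).toContinuousLinearEquiv
  refine ⟨⟨ContinuousLinearEquiv.toUnit e, hL⟩, ?_⟩
  ext1 x
  rfl

/-- By isometry, `⟨g a, h b⟩ = ⟨a, g⁻¹ h b⟩`, so these products determine `g⁻¹ h`. Local constancy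
of transition functions thus reduces to that of metric products. -/
theorem inv_mul_eq_of_metric_eq {g h g' h' : Opq p q}
    (H : ∀ a b, metric p q (g.val.val a) (h.val.val b) = metric p q (g'.val.val a) (h'.val.val b)) :
    g⁻¹ * h = g'⁻¹ * h' := by
  have key : ∀ (g h : Opq p q) (a b : Rpq p q),
      metric p q a ((g⁻¹ * h).val.val b) = metric p q (g.val.val a) (h.val.val b) := fun g h a b ↦ by
    rw [← g.2 a]
    have : g.val.val ((g⁻¹ * h).val.val b) = (g * (g⁻¹ * h)).val.val b := rfl
    rw [this, mul_inv_cancel_left]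
  refine Subtype.ext (Units.ext (ContinuousLinearMap.ext fun b ↦ eq_of_metric_eq fun a ↦ ?_))
  rw [key, key, H]

end Metric

section Parallel

open Topology Filter Set Metric

variable {p q : ℕ} {E : Type*} [NormedAddCommGroup E] [NormedSpace ℝ E]

/-- Parallel frames of a metric connection have constant products. -/
theorem metric_parallel_eq {Ω : E → E →L[ℝ] Rpq p q →L[ℝ] Rpq p q}
    {f g : E → Rpq p q →L[ℝ] Rpq p q} {s : Set E} (hs : IsOpen s) (hsc : Convex ℝ s)
    (hΩ : ∀ y ∈ s, ∀ u, Ω y u ∈ opq p q)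
    (hf : ∀ y ∈ s, HasFDerivAt f (parallelDeriv (Ω y) (f y)) y)
    (hg : ∀ y ∈ s, HasFDerivAt g (parallelDeriv (Ω y) (g y)) y)
    {x y : E} (hx : x ∈ s) (hy : y ∈ s) (a b : Rpq p q) :
    metric p q (f y a) (g y b) = metric p q (f x a) (g x b) := by
  have key : ∀ z ∈ s, HasFDerivAt (fun z ↦ metricCLM p q (f z a) (g z b)) (0 : E →L[ℝ] ℝ) z := by
    intro z hz
    have h1 : HasFDerivAt (fun z ↦ f z a) ((ContinuousLinearMap.apply ℝ (Rpq p q) a).comp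
        (parallelDeriv (Ω z) (f z))) z :=
      (ContinuousLinearMap.apply ℝ (Rpq p q) a).hasFDerivAt.comp z (hf z hz)
    have h2 : HasFDerivAt (fun z ↦ g z b) ((ContinuousLinearMap.apply ℝ (Rpq p q) b).comp
        (parallelDeriv (Ω z) (g z))) z :=
      (ContinuousLinearMap.apply ℝ (Rpq p q) b).hasFDerivAt.comp z (hg z hz)
    have h3 := (metricCLM p q).hasFDerivAt_of_bilinear h1 h2
    convert! h3 using 1
    ext u
    -- Skewness of `Ω` cancels the two terms of the product rule.
    have := hΩ z hz u (f z a) (g z b)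
    simp only [← metricCLM_apply] at this
    simp only [zero_apply, add_apply, ContinuousLinearMap.precompR_apply,
      ContinuousLinearMap.precompL_apply, ContinuousLinearMap.compL_apply, ContinuousLinearMap.comp_apply, parallelDeriv_apply,
      ContinuousLinearMap.apply_apply, neg_apply, mul_apply_eq_comp, map_neg]
    linarith
  exact hs.is_const_of_fderiv_eq_zero hsc.isPreconnected
    (fun z hz ↦ (key z hz).differentiableAt.differentiableWithinAt)
    (fun z hz ↦ (key z hz).fderiv) hy hx

end Parallel

/-! ### Linear and translation parts of affine endomorphisms. -/

section Blocks

variable {p q : ℕ}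

/-- The linear part `ξ` of the block matrix with rows `(ξ, v)` and `(0, c)`. -/
noncomputable def linPart (p q : ℕ) : AffEnd p q →L[ℝ] Rpq p q →L[ℝ] Rpq p q :=
  (ContinuousLinearMap.compL ℝ (Rpq p q) (Rpq p q × ℝ) (Rpq p q)
    (ContinuousLinearMap.fst ℝ (Rpq p q) ℝ)).comp
    ((ContinuousLinearMap.compL ℝ (Rpq p q) (Rpq p q × ℝ) (Rpq p q × ℝ)).flip
      (ContinuousLinearMap.inl ℝ (Rpq p q) ℝ))

theorem linPart_apply (X : AffEnd p q) (w : Rpq p q) : linPart p q X w = (X (w, 0)).1 := rfl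

/-- The translation part `v` of the block matrix with rows `(ξ, v)` and `(0, c)`. -/
noncomputable def transPart (p q : ℕ) : AffEnd p q →L[ℝ] Rpq p q :=
  (ContinuousLinearMap.fst ℝ (Rpq p q) ℝ).comp
    (ContinuousLinearMap.apply ℝ (Rpq p q × ℝ) ((0, 1) : Rpq p q × ℝ))

theorem transPart_apply (X : AffEnd p q) : transPart p q X = (X (0, 1)).1 := rfl

@[simp] theorem linPart_block (ξ : Rpq p q →L[ℝ] Rpq p q) (v : Rpq p q) (c : ℝ) :
    linPart p q (block ξ v c) = ξ := by
  ext1 w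
  simp [linPart_apply]

@[simp] theorem transPart_block (ξ : Rpq p q →L[ℝ] Rpq p q) (v : Rpq p q) (c : ℝ) :
    transPart p q (block ξ v c) = v := by
  simp [transPart_apply]

theorem block_mul_block (ξ ζ : Rpq p q →L[ℝ] Rpq p q) (v w : Rpq p q) (c d : ℝ) :
    block ξ v c * block ζ w d = block (ξ * ζ) (ξ w + d • v) (c * d) := by
  refine ContinuousLinearMap.ext fun z ↦ Prod.ext ?_ ?_
  · simp [add_assoc, smul_smul, mul_comm]
  · simp [mul_assoc]

theorem block_add_block (ξ ζ : Rpq p q →L[ℝ] Rpq p q) (v w : Rpq p q) (c d : ℝ) :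
    block ξ v c + block ζ w d = block (ξ + ζ) (v + w) (c + d) := by
  refine ContinuousLinearMap.ext fun z ↦ ?_
  simp [add_add_add_comm, add_mul]

theorem eq_block_of_mem_iopq {X : AffEnd p q} (hX : X ∈ iopq p q) :
    X = block (linPart p q X) (transPart p q X) 0 := by
  obtain ⟨ξ, -, v, rfl⟩ := hX
  simp

theorem linPart_mem_opq {X : AffEnd p q} (hX : X ∈ iopq p q) : linPart p q X ∈ opq p q := by
  obtain ⟨ξ, hξ, v, rfl⟩ := hX
  simpa using hξ

theorem linPart_mul {X Y : AffEnd p q} (hX : X ∈ iopq p q) (hY : Y ∈ iopq p q) :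
    linPart p q (X * Y) = linPart p q X * linPart p q Y := by
  obtain ⟨ξ, -, v, rfl⟩ := hX
  obtain ⟨ζ, -, w, rfl⟩ := hY
  simp [block_mul_block]

/-- The lower right entry of `Y` is zero, so the translation part of `X` drops out. This is why the
translation part of `A ∧ A` is `ω ∧ e`. -/
theorem transPart_mul {X Y : AffEnd p q} (hX : X ∈ iopq p q) (hY : Y ∈ iopq p q) :
    transPart p q (X * Y) = linPart p q X (transPart p q Y) := by
  obtain ⟨ξ, -, v, rfl⟩ := hX
  obtain ⟨ζ, -, w, rfl⟩ := hY
  simp [block_mul_block]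

theorem linPart_tInf (v : Rpq p q) : linPart p q (tInf v) = 0 := linPart_block _ _ _

theorem transPart_tInf (v : Rpq p q) : transPart p q (tInf v) = v := transPart_block _ _ _

end Blocks

end Teleparallel

/-! ### The flat `𝔬(p,q)`-part of a 2-connection and its global parallel frames. -/

namespace Teleparallel

theorem fderiv_const_clm_comp_apply {E F G : Type*} [NormedAddCommGroup E] [NormedSpace ℝ E]
    [NormedAddCommGroup F] [NormedSpace ℝ F] [NormedAddCommGroup G] [NormedSpace ℝ G]
    (L : F →L[ℝ] G) {f : E → E →L[ℝ] F} {y : E} (h : DifferentiableAt ℝ f y) (u v : E) :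
    fderiv ℝ (fun z ↦ L.comp (f z)) y u v = L (fderiv ℝ f y u v) := by
  have h1 : HasFDerivAt f (fderiv ℝ f y) y := h.hasFDerivAt
  have h2 := (ContinuousLinearMap.compL ℝ E F G L).hasFDerivAt.comp y h1
  exact congr($(h2.fderiv) u v)

section Connection

open Topology Filter Set Metric

variable {p q : ℕ} {E : Type*} [NormedAddCommGroup E] [NormedSpace ℝ E]
  {M : Type*} [TopologicalSpace M] [ChartedSpace E M]

namespace TwoConnection

variable (C : TwoConnection p q E M)

/-- The coordinate expression of the `𝔦𝔬(p,q)`-valued form of a 2-connection. -/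
noncomputable def coordA (x₀ : M) (y : E) : E →L[ℝ] AffEnd p q := oneFormCLM (C.A.inChart x₀ y)

/-- The coordinate expression of the `𝔬(p,q)`-part of a 2-connection. -/
noncomputable def coordLin (x₀ : M) (y : E) : E →L[ℝ] Rpq p q →L[ℝ] Rpq p q :=
  (linPart p q).comp (C.coordA x₀ y)

theorem coordLin_apply (x₀ : M) (y u : E) : C.coordLin x₀ y u = linPart p q (C.coordA x₀ y u) := rfl

theorem coordA_apply (x₀ : M) (y u : E) : C.coordA x₀ y u = C.A.inChart x₀ y ![u] :=
  oneFormCLM_apply _ _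

theorem coordA_mem (x₀ : M) (y u : E) : C.coordA x₀ y u ∈ iopq p q := by
  rw [coordA_apply, DiffForm.inChart_apply]
  convert! C.A_mem ((extChartAt 𝓘(ℝ, E) x₀).symm y)
    (mfderiv 𝓘(ℝ, E) 𝓘(ℝ, E) (extChartAt 𝓘(ℝ, E) x₀).symm y u) using 2
  ext i
  simp

theorem coordLin_mem (x₀ : M) (y u : E) : C.coordLin x₀ y u ∈ opq p q :=
  linPart_mem_opq (C.coordA_mem x₀ y u)

theorem contDiffOn_coordA (x₀ : M) :
    ContDiffOn ℝ ∞ (C.coordA x₀) (extChartAt 𝓘(ℝ, E) x₀).target :=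
  (oneFormCLM (E := E) (F := AffEnd p q)).contDiff.comp_contDiffOn (C.smooth_A x₀)

theorem contDiffOn_coordLin (x₀ : M) :
    ContDiffOn ℝ ∞ (C.coordLin x₀) (extChartAt 𝓘(ℝ, E) x₀).target :=
  contDiffOn_const.clm_comp (C.contDiffOn_coordA x₀)

variable {C} in
theorem differentiableAt_coordA {x₀ : M} {y : E} (hy : y ∈ (extChartAt 𝓘(ℝ, E) x₀).target) :
    DifferentiableAt ℝ (C.coordA x₀) y :=
  ((C.contDiffOn_coordA x₀).contDiffAt ((isOpen_extChartAt_target x₀).mem_nhds hy)).differentiableAt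
    (by simp)

section

variable [IsManifold 𝓘(ℝ, E) ∞ M]

/-- The transformation law of the 1-form `ω`, which makes the equation `dF = -ω F` independent of
the chart. -/
theorem coordLin_eq_comp {x₀ x₁ : M} {y : E} (hy : y ∈ (extChartAt 𝓘(ℝ, E) x₁).target)
    (hy' : (extChartAt 𝓘(ℝ, E) x₁).symm y ∈ (extChartAt 𝓘(ℝ, E) x₀).source) :
    C.coordLin x₁ y =
      (C.coordLin x₀ (extChartAt 𝓘(ℝ, E) x₀ ((extChartAt 𝓘(ℝ, E) x₁).symm y))).comp
        (fderiv ℝ (extChartAt 𝓘(ℝ, E) x₀ ∘ (extChartAt 𝓘(ℝ, E) x₁).symm) y) := by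
  ext1 u
  rw [ContinuousLinearMap.comp_apply, coordLin_apply, coordLin_apply, coordA_apply, coordA_apply,
    C.A.inChart_eq_pullback hy hy', ContinuousAlternatingMap.compContinuousLinearMap_apply]
  congr 2
  ext i
  simp

/-- The fake flatness condition in coordinates. -/
theorem fake_flat_coord {x₀ : M} {y : E} (hy : y ∈ (extChartAt 𝓘(ℝ, E) x₀).target) (u v : E) :
    fderiv ℝ (C.coordA x₀) y u v - fderiv ℝ (C.coordA x₀) y v u +
      (C.coordA x₀ y u * C.coordA x₀ y v - C.coordA x₀ y v * C.coordA x₀ y u) =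
      tInf (C.B.inChart x₀ y ![u, v]) := by
  have h := C.fake_flat ((extChartAt 𝓘(ℝ, E) x₀).symm y)
    (mfderiv 𝓘(ℝ, E) 𝓘(ℝ, E) (extChartAt 𝓘(ℝ, E) x₀).symm y u)
    (mfderiv 𝓘(ℝ, E) 𝓘(ℝ, E) (extChartAt 𝓘(ℝ, E) x₀).symm y v)
  have e1 : ∀ w : E, C.A ((extChartAt 𝓘(ℝ, E) x₀).symm y)
      ![mfderiv 𝓘(ℝ, E) 𝓘(ℝ, E) (extChartAt 𝓘(ℝ, E) x₀).symm y w] = C.coordA x₀ y w := fun w ↦ by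
    rw [coordA_apply, DiffForm.inChart_apply]
    congr 1
    ext i
    simp
  have e2 : ∀ {G : Type} [NormedAddCommGroup G] [NormedSpace ℝ G] (θ : DiffForm E M G 2),
      θ ((extChartAt 𝓘(ℝ, E) x₀).symm y)
      ![mfderiv 𝓘(ℝ, E) 𝓘(ℝ, E) (extChartAt 𝓘(ℝ, E) x₀).symm y u,
        mfderiv 𝓘(ℝ, E) 𝓘(ℝ, E) (extChartAt 𝓘(ℝ, E) x₀).symm y v] = θ.inChart x₀ y ![u, v] := by
    intro G _ _ θ
    rw [DiffForm.inChart_apply]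
    congr 1
    ext i
    fin_cases i <;> rfl
  rw [e1, e1, e2, e2, C.smooth_A.inChart_d hy, extDeriv_oneForm_apply] at h
  exact h

/-- The linear part of fake flatness: `t(B)` is a pure translation, and taking linear parts is
multiplicative on `𝔦𝔬(p,q)`. -/
theorem flat_coordLin {x₀ : M} {y : E} (hy : y ∈ (extChartAt 𝓘(ℝ, E) x₀).target) (u v : E) :
    fderiv ℝ (C.coordLin x₀) y u v - fderiv ℝ (C.coordLin x₀) y v u +
      (C.coordLin x₀ y u * C.coordLin x₀ y v - C.coordLin x₀ y v * C.coordLin x₀ y u) = 0 := by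
  have h := congrArg (linPart p q) (C.fake_flat_coord hy u v)
  have hd : ∀ u v, fderiv ℝ (C.coordLin x₀) y u v =
      linPart p q (fderiv ℝ (C.coordA x₀) y u v) :=
    fderiv_const_clm_comp_apply (linPart p q) (differentiableAt_coordA hy)
  rw [linPart_tInf, map_add, map_sub, map_sub, linPart_mul (C.coordA_mem _ _ _)
    (C.coordA_mem _ _ _), linPart_mul (C.coordA_mem _ _ _) (C.coordA_mem _ _ _)] at h
  rw [hd, hd]
  exact h

end

/-- A map `F` into endomorphisms of `ℝ^{p,q}` is parallel at `x` for the `𝔬(p,q)`-part `ω` of a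
2-connection if `dF = -ω F` there, in every chart. -/
def IsParallelAt (F : M → Rpq p q →L[ℝ] Rpq p q) (x : M) : Prop :=
  ∀ x₀ : M, x ∈ (extChartAt 𝓘(ℝ, E) x₀).source →
    HasFDerivAt (F ∘ (extChartAt 𝓘(ℝ, E) x₀).symm)
      (parallelDeriv (C.coordLin x₀ (extChartAt 𝓘(ℝ, E) x₀ x)) (F x)) (extChartAt 𝓘(ℝ, E) x₀ x)

variable {C}

theorem IsParallelAt.hasFDerivAt {F : M → Rpq p q →L[ℝ] Rpq p q} {x₀ : M} {y : E}
    (hy : y ∈ (extChartAt 𝓘(ℝ, E) x₀).target)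
    (hF : C.IsParallelAt F ((extChartAt 𝓘(ℝ, E) x₀).symm y)) :
    HasFDerivAt (F ∘ (extChartAt 𝓘(ℝ, E) x₀).symm)
      (parallelDeriv (C.coordLin x₀ y) ((F ∘ (extChartAt 𝓘(ℝ, E) x₀).symm) y)) y := by
  have := hF x₀ ((extChartAt 𝓘(ℝ, E) x₀).map_target hy)
  rwa [(extChartAt 𝓘(ℝ, E) x₀).right_inv hy] at this

theorem IsParallelAt.congr {F G : M → Rpq p q →L[ℝ] Rpq p q} {x : M} (hF : C.IsParallelAt F x)
    (h : G =ᶠ[𝓝 x] F) : C.IsParallelAt G x := by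
  intro x₀ hx
  rw [h.eq_of_nhds]
  refine (hF x₀ hx).congr_of_eventuallyEq ?_
  have hc := continuousAt_extChartAt_symm' (I := 𝓘(ℝ, E)) hx
  rw [ContinuousAt, (extChartAt 𝓘(ℝ, E) x₀).left_inv hx] at hc
  exact hc.eventually h

/-- In `dF = -ω F` the connection acts from the left, so constant right factors are harmless. They
are the freedom used to glue local frames. -/
theorem IsParallelAt.mul_const {F : M → Rpq p q →L[ℝ] Rpq p q} {x : M} (hF : C.IsParallelAt F x)
    (c : Rpq p q →L[ℝ] Rpq p q) : C.IsParallelAt (fun y ↦ F y * c) x := by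
  intro x₀ hx
  have h := ((ContinuousLinearMap.mul ℝ (Rpq p q →L[ℝ] Rpq p q)).flip c).hasFDerivAt.comp _
    (hF x₀ hx)
  refine h.congr_fderiv ?_
  ext1 u
  simp [mul_assoc]

variable [IsManifold 𝓘(ℝ, E) ∞ M]

/-- By the chain rule and `coordLin_eq_comp`, one chart around `x` suffices. -/
theorem isParallelAt_of_hasFDerivAt {F : M → Rpq p q →L[ℝ] Rpq p q} {x x₀ : M}
    (hx : x ∈ (extChartAt 𝓘(ℝ, E) x₀).source)
    (hF : HasFDerivAt (F ∘ (extChartAt 𝓘(ℝ, E) x₀).symm)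
      (parallelDeriv (C.coordLin x₀ (extChartAt 𝓘(ℝ, E) x₀ x)) (F x)) (extChartAt 𝓘(ℝ, E) x₀ x)) :
    C.IsParallelAt F x := by
  intro x₁ hx₁
  set y := extChartAt 𝓘(ℝ, E) x₁ x with hy
  have hyx : (extChartAt 𝓘(ℝ, E) x₁).symm y = x := (extChartAt 𝓘(ℝ, E) x₁).left_inv hx₁
  have hyt : y ∈ (extChartAt 𝓘(ℝ, E) x₁).target := (extChartAt 𝓘(ℝ, E) x₁).map_source hx₁
  have hys : (extChartAt 𝓘(ℝ, E) x₁).symm y ∈ (extChartAt 𝓘(ℝ, E) x₀).source := by rwa [hyx]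
  have hψ := ((contDiffAt_extChartAt_comp_symm hyt hys).differentiableAt (by simp)).hasFDerivAt
  have hψy : (extChartAt 𝓘(ℝ, E) x₀ ∘ (extChartAt 𝓘(ℝ, E) x₁).symm) y =
      extChartAt 𝓘(ℝ, E) x₀ x := by rw [Function.comp_apply, hyx]
  rw [← hψy] at hF
  have h := (HasFDerivAt.comp y hF hψ).congr_of_eventuallyEq
    (f₁ := F ∘ (extChartAt 𝓘(ℝ, E) x₁).symm) (by
      filter_upwards [eventually_symm_mem_source hyt hys] with z hz
      simp only [Function.comp_apply]
      rw [(extChartAt 𝓘(ℝ, E) x₀).left_inv hz.2])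
  refine h.congr_fderiv ?_
  ext1 u
  rw [C.coordLin_eq_comp hyt hys]
  rfl

omit [IsManifold 𝓘(ℝ, E) ∞ M] in
/-- Products of parallel frames are locally constant. -/
theorem IsParallelAt.eventually_metric_eq {F G : M → Rpq p q →L[ℝ] Rpq p q} {x : M}
    (hF : ∀ᶠ y in 𝓝 x, C.IsParallelAt F y) (hG : ∀ᶠ y in 𝓝 x, C.IsParallelAt G y) :
    ∀ᶠ y in 𝓝 x, ∀ a b, metric p q (F y a) (G y b) = metric p q (F x a) (G x b) := by
  have hc := continuousAt_extChartAt_symm (I := 𝓘(ℝ, E)) x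
  rw [ContinuousAt, extChartAt_to_inv] at hc
  obtain ⟨r, hr, hball⟩ := Metric.eventually_nhds_iff_ball.1
    ((hc.eventually (hF.and hG)).and (extChartAt_target_mem_nhds (I := 𝓘(ℝ, E)) x))
  have hx : extChartAt 𝓘(ℝ, E) x x ∈ ball (extChartAt 𝓘(ℝ, E) x x) r := mem_ball_self hr
  filter_upwards [(continuousAt_extChartAt (I := 𝓘(ℝ, E)) x).eventually (ball_mem_nhds _ hr),
    extChartAt_source_mem_nhds (I := 𝓘(ℝ, E)) x] with y hy hys a b
  have := metric_parallel_eq isOpen_ball (convex_ball _ _) (fun z _ u ↦ C.coordLin_mem x z u)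
    (fun z hz ↦ IsParallelAt.hasFDerivAt (hball z hz).2 (hball z hz).1.1)
    (fun z hz ↦ IsParallelAt.hasFDerivAt (hball z hz).2 (hball z hz).1.2) hx hy a b
  simp only [Function.comp_apply, extChartAt_to_inv,
    (extChartAt 𝓘(ℝ, E) x).left_inv hys] at this
  exact this

/-- Parallel frames with values in `O(p,q)` exist locally. -/
theorem exists_local_parallel (C : TwoConnection p q E M) (x₀ : M) :
    ∃ V : Set M, IsOpen V ∧ x₀ ∈ V ∧ ∃ F : M → Opq p q,
      ∀ x ∈ V, C.IsParallelAt (fun y ↦ (F y).val.val) x := by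
  have ht : (extChartAt 𝓘(ℝ, E) x₀).target ∈ 𝓝 (extChartAt 𝓘(ℝ, E) x₀ x₀) :=
    extChartAt_target_mem_nhds x₀
  obtain ⟨r, hr, f, hsub, hf1, hf⟩ := exists_local_parallel_frame ht
    (((C.contDiffOn_coordLin x₀).contDiffAt ht).of_le
      (WithTop.coe_le_coe.2 (le_top : (2 : ℕ∞) ≤ ⊤)))
    (fun z hz u v ↦ C.flat_coordLin hz u v)
  set V := (extChartAt 𝓘(ℝ, E) x₀).source ∩
    extChartAt 𝓘(ℝ, E) x₀ ⁻¹' ball (extChartAt 𝓘(ℝ, E) x₀ x₀) r with hV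
  have hVo : IsOpen V := isOpen_extChartAt_preimage' x₀ isOpen_ball
  have hpar : ∀ x ∈ V, C.IsParallelAt (f ∘ extChartAt 𝓘(ℝ, E) x₀) x := by
    rintro x ⟨hx, hxb⟩
    refine isParallelAt_of_hasFDerivAt hx ((hf _ hxb).congr_of_eventuallyEq ?_)
    filter_upwards [isOpen_ball.mem_nhds hxb] with z hz
    simp only [Function.comp_apply]
    rw [(extChartAt 𝓘(ℝ, E) x₀).right_inv (hsub hz)]
  -- The metric products of the columns of `f` are constant on the ball, and `f` is the identity at
  -- its centre.
  have hiso : ∀ x ∈ V, ∃ g : Opq p q, g.val.val = f (extChartAt 𝓘(ℝ, E) x₀ x) := by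
    rintro x ⟨hx, hxb⟩
    refine exists_Opq_of_isometry fun a b ↦ ?_
    rw [metric_parallel_eq isOpen_ball (convex_ball _ _) (fun z _ u ↦ C.coordLin_mem x₀ z u)
      hf hf (mem_ball_self hr) hxb a b, hf1]
    rfl
  choose! F hF using hiso
  refine ⟨V, hVo, ⟨mem_extChartAt_source x₀, mem_ball_self hr⟩, F, fun x hx ↦ ?_⟩
  refine (hpar x hx).congr ?_
  filter_upwards [hVo.mem_nhds hx] with y hy
  exact hF y hy

/-- If all fundamental groups are trivial, parallel frames with values in `O(p,q)` exist
globally. -/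
theorem exists_parallel (C : TwoConnection p q E M)
    (hM : ∀ x : M, Subsingleton (FundamentalGroup M x)) :
    ∃ F : M → Opq p q, ∀ x, C.IsParallelAt (fun y ↦ (F y).val.val) x := by
  have : LocallyPathConnectedSpace M := ChartedSpace.locallyPathConnectedSpace E M
  choose V hV hmem f hf using C.exists_local_parallel
  have hev : ∀ i, ∀ x ∈ V i, ∀ᶠ y in 𝓝 x, C.IsParallelAt (fun z ↦ (f i z).val.val) y :=
    fun i x hx ↦ by
      filter_upwards [(hV i).mem_nhds hx] with y hy
      exact hf i y hy
  obtain ⟨F, hF⟩ := exists_global_of_locallyConstant_cocycle hM V hV (fun x ↦ ⟨x, hmem x⟩) f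
    (fun i j x hx ↦ by
      filter_upwards [IsParallelAt.eventually_metric_eq (hev i x hx.1) (hev j x hx.2)] with y hy
      exact inv_mul_eq_of_metric_eq hy)
  -- Near `x` the glued frame is the local frame around `x` times the constant `(f x x)⁻¹ * F x`.
  refine ⟨F, fun x ↦ ((hf x x (hmem x)).mul_const ((f x x)⁻¹ * F x).val.val).congr ?_⟩
  filter_upwards [hF x x (hmem x)] with y hy
  rw [inv_mul_eq_iff_eq_mul.1 hy]
  rfl

omit [IsManifold 𝓘(ℝ, E) ∞ M] in
theorem contDiffOn_of_isParallelAt {F : M → Rpq p q →L[ℝ] Rpq p q}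
    (hF : ∀ x, C.IsParallelAt F x) (x₀ : M) :
    ContDiffOn ℝ ∞ (F ∘ (extChartAt 𝓘(ℝ, E) x₀).symm) (extChartAt 𝓘(ℝ, E) x₀).target :=
  contDiffOn_of_hasFDerivAt_parallel (isOpen_extChartAt_target x₀) (C.contDiffOn_coordLin x₀)
    fun _ hy ↦ IsParallelAt.hasFDerivAt hy (hF _)

end TwoConnection

end Connection

end Teleparallel

/-! ### Derivatives of intertwiners. -/

section GaugeDerivative

variable {E : Type*} [NormedAddCommGroup E] [NormedSpace ℝ E]

section

variable {R : Type*} [NormedRing R] [NormedAlgebra ℝ R]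

/-- The derivative `h ↦ l * Ω h - Ω' h * l` of a map intertwining parallel frames of `Ω`
and `Ω'`. -/
noncomputable def intertwinerDeriv (Ω Ω' : E →L[ℝ] R) (l : R) : E →L[ℝ] R :=
  (ContinuousLinearMap.mul ℝ R l).comp Ω - ((ContinuousLinearMap.mul ℝ R).flip l).comp Ω'

@[simp] theorem intertwinerDeriv_apply (Ω Ω' : E →L[ℝ] R) (l : R) (h : E) :
    intertwinerDeriv Ω Ω' l h = l * Ω h - Ω' h * l := rfl

variable [CompleteSpace R]

/-- From `d(Φ⁻¹) = -Φ⁻¹ dΦ Φ⁻¹ = Φ⁻¹ Ω` and `dΦ' = -Ω' Φ'`, by the product rule. -/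
theorem hasFDerivAt_parallel_mul_inv {Ω Ω' : E →L[ℝ] R} {Φ Φ' : E → Rˣ} {y : E}
    (hΦ : HasFDerivAt (fun z ↦ (Φ z : R)) (parallelDeriv Ω (Φ y : R)) y)
    (hΦ' : HasFDerivAt (fun z ↦ (Φ' z : R)) (parallelDeriv Ω' (Φ' y : R)) y) :
    HasFDerivAt (fun z ↦ ((Φ' z * (Φ z)⁻¹ : Rˣ) : R))
      (intertwinerDeriv Ω Ω' ((Φ' y * (Φ y)⁻¹ : Rˣ) : R)) y := by
  have h0 : HasFDerivAt (Ring.inverse : R → R) _ (Φ y : R) :=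
    hasFDerivAt_ringInverse (𝕜 := ℝ) (Φ y)
  have h2 := hΦ'.mul' (h0.comp y hΦ)
  simp only [Function.comp_apply, Ring.inverse_unit] at h2
  have e : (fun z ↦ ((Φ' z * (Φ z)⁻¹ : Rˣ) : R)) =
      (fun z ↦ (Φ' z : R)) * (Ring.inverse ∘ fun z ↦ (Φ z : R)) := by
    funext z
    simp
  rw [e]
  refine h2.congr_fderiv ?_
  ext u
  simp [mul_assoc]
  abel

theorem contDiffOn_mul_inv {Φ Φ' : E → Rˣ} {s : Set E} {n : WithTop ℕ∞}
    (hΦ : ContDiffOn ℝ n (fun z ↦ (Φ z : R)) s) (hΦ' : ContDiffOn ℝ n (fun z ↦ (Φ' z : R)) s) :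
    ContDiffOn ℝ n (fun z ↦ ((Φ' z * (Φ z)⁻¹ : Rˣ) : R)) s := by
  have h : ContDiffOn ℝ n (fun z ↦ Ring.inverse (Φ z : R)) s := fun y hy ↦
    ContDiffAt.comp_contDiffWithinAt (g := (Ring.inverse : R → R)) y
      (contDiffAt_ringInverse ℝ (Φ y)) (hΦ y hy)
  simp only [Ring.inverse_unit] at h
  exact hΦ'.mul h

end

theorem fderiv_clm_comp_apply {W V : Type*} [NormedAddCommGroup W] [NormedSpace ℝ W]
    [NormedAddCommGroup V] [NormedSpace ℝ V] {l : E → W →L[ℝ] V} {e : E → E →L[ℝ] W}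
    {l' : E →L[ℝ] W →L[ℝ] V} {y : E} (hl : HasFDerivAt l l' y) (he : DifferentiableAt ℝ e y)
    (u v : E) :
    fderiv ℝ (fun z ↦ (l z).comp (e z)) y u v = l' u (e y v) + l y (fderiv ℝ e y u v) := by
  rw [(hl.clm_comp he.hasFDerivAt).fderiv]
  simp [add_comm]

theorem fderiv_sub_clm_comp_apply {W V : Type*} [NormedAddCommGroup W] [NormedSpace ℝ W]
    [NormedAddCommGroup V] [NormedSpace ℝ V] {l : E → W →L[ℝ] V} {e : E → E →L[ℝ] W}
    {e' : E → E →L[ℝ] V} {l' : E →L[ℝ] W →L[ℝ] V} {y : E} (hl : HasFDerivAt l l' y)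
    (he : DifferentiableAt ℝ e y) (he' : DifferentiableAt ℝ e' y) (u v : E) :
    fderiv ℝ (fun z ↦ e' z - (l z).comp (e z)) y u v =
      fderiv ℝ e' y u v - (l' u (e y v) + l y (fderiv ℝ e y u v)) := by
  rw [fderiv_fun_sub he' (hl.clm_comp he.hasFDerivAt).differentiableAt,
    sub_apply, sub_apply, fderiv_clm_comp_apply hl he]

end GaugeDerivative

/-! ### The gauge transformation built from two parallel frames. -/

namespace Teleparallel

section Smoothness

variable {E : Type*} [NormedAddCommGroup E] [NormedSpace ℝ E]
  {M : Type*} [TopologicalSpace M] [ChartedSpace E M]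
  {V : Type*} [NormedAddCommGroup V] [NormedSpace ℝ V]

theorem contMDiff_of_contDiffOn_symm [IsManifold 𝓘(ℝ, E) ∞ M] {f : M → V}
    (hf : ∀ x₀ : M, ContDiffOn ℝ ∞ (f ∘ (extChartAt 𝓘(ℝ, E) x₀).symm)
      (extChartAt 𝓘(ℝ, E) x₀).target) : ContMDiff 𝓘(ℝ, E) 𝓘(ℝ, V) ∞ f := by
  intro x
  have h1 : ContMDiffAt 𝓘(ℝ, E) 𝓘(ℝ, V) ∞ (f ∘ (extChartAt 𝓘(ℝ, E) x).symm)
      (extChartAt 𝓘(ℝ, E) x x) :=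
    ((hf x).contDiffAt (extChartAt_target_mem_nhds x)).contMDiffAt
  refine (h1.comp x (contMDiffAt_extChartAt_of_mem (mem_extChartAt_source x))).congr_of_eventuallyEq
    ?_
  filter_upwards [extChartAt_source_mem_nhds (I := 𝓘(ℝ, E)) x] with y hy
  simp only [Function.comp_apply]
  rw [(extChartAt 𝓘(ℝ, E) x).left_inv hy]

theorem mvfderiv_apply_eq_fderiv {f : M → V} {x : M}
    (hf : MDifferentiableAt 𝓘(ℝ, E) 𝓘(ℝ, V) f x) (u : TangentSpace 𝓘(ℝ, E) x) :
    mvfderiv 𝓘(ℝ, E) f x u =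
      fderiv ℝ (f ∘ (extChartAt 𝓘(ℝ, E) x).symm) (extChartAt 𝓘(ℝ, E) x x) u := by
  have h : mfderiv 𝓘(ℝ, E) 𝓘(ℝ, V) f x =
      fderiv ℝ (f ∘ (extChartAt 𝓘(ℝ, E) x).symm) (extChartAt 𝓘(ℝ, E) x x) := by
    rw [hf.mfderiv]
    simp only [modelWithCornersSelf_coe, Set.range_id, fderivWithin_univ]
    rfl
  exact congr($h u)

end Smoothness

section GaugeTransformation

open Topology Filter Set

variable {p q : ℕ} {E : Type*} [NormedAddCommGroup E] [NormedSpace ℝ E]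
  {M : Type*} [TopologicalSpace M] [ChartedSpace E M]

/-- The linear map `ξ ↦ block ξ 0 0`. -/
noncomputable def blockLin (p q : ℕ) : (Rpq p q →L[ℝ] Rpq p q) →L[ℝ] AffEnd p q :=
  (ContinuousLinearMap.compL ℝ (Rpq p q × ℝ) (Rpq p q) (Rpq p q × ℝ)
    (ContinuousLinearMap.inl ℝ (Rpq p q) ℝ)).comp
    ((ContinuousLinearMap.compL ℝ (Rpq p q × ℝ) (Rpq p q) (Rpq p q)).flip
      (ContinuousLinearMap.fst ℝ (Rpq p q) ℝ))

theorem blockLin_apply (ξ : Rpq p q →L[ℝ] Rpq p q) : blockLin p q ξ = block ξ 0 0 := by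
  refine ContinuousLinearMap.ext fun z ↦ ?_
  simp [blockLin]

/-- The rotation `h ∈ O(p,q)` as an element of `IO(p,q)`. -/
noncomputable def rotation (h : Opq p q) : IOpq p q := SemidirectProduct.inr h

theorem affine_rotation (h : Opq p q) :
    affine (rotation h) = blockLin p q h.val.val + block 0 0 1 := by
  rw [blockLin_apply, block_add_block, add_zero, add_zero, zero_add]
  rfl

theorem affine_rotation_eq_block (h : Opq p q) : affine (rotation h) = block h.val.val 0 1 := rfl

theorem rotation_inv (h : Opq p q) : (rotation h)⁻¹ = rotation h⁻¹ := (map_inv _ _).symm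

theorem alpha_rotation (h : Opq p q) (w : Rpq p q) : alpha (rotation h) w = h.val.val w := rfl

namespace TwoConnection

/-- The equation `dΛ = Λ ω - ω' Λ` for `Λ = F' F⁻¹`. With the two 2-connections exchanged it also
gives `d(Λ⁻¹)`. -/
theorem hasFDerivAt_intertwiner {C C' : TwoConnection p q E M} {F F' : M → Opq p q}
    (hF : ∀ x, C.IsParallelAt (fun y ↦ (F y).val.val) x)
    (hF' : ∀ x, C'.IsParallelAt (fun y ↦ (F' y).val.val) x) {x₀ : M} {y : E}
    (hy : y ∈ (extChartAt 𝓘(ℝ, E) x₀).target) :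
    HasFDerivAt ((fun x ↦ (F' x * (F x)⁻¹).val.val) ∘ (extChartAt 𝓘(ℝ, E) x₀).symm)
      (intertwinerDeriv (C.coordLin x₀ y) (C'.coordLin x₀ y)
        (F' ((extChartAt 𝓘(ℝ, E) x₀).symm y) * (F ((extChartAt 𝓘(ℝ, E) x₀).symm y))⁻¹).val.val) y :=
  hasFDerivAt_parallel_mul_inv (Φ := fun z ↦ (F ((extChartAt 𝓘(ℝ, E) x₀).symm z)).val)
    (Φ' := fun z ↦ (F' ((extChartAt 𝓘(ℝ, E) x₀).symm z)).val)
    (IsParallelAt.hasFDerivAt hy (hF _)) (IsParallelAt.hasFDerivAt hy (hF' _))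

theorem contDiffOn_intertwiner {C C' : TwoConnection p q E M} {F F' : M → Opq p q}
    (hF : ∀ x, C.IsParallelAt (fun y ↦ (F y).val.val) x)
    (hF' : ∀ x, C'.IsParallelAt (fun y ↦ (F' y).val.val) x) (x₀ : M) :
    ContDiffOn ℝ ∞ ((fun x ↦ (F' x * (F x)⁻¹).val.val) ∘ (extChartAt 𝓘(ℝ, E) x₀).symm)
      (extChartAt 𝓘(ℝ, E) x₀).target :=
  contDiffOn_mul_inv (Φ := fun z ↦ (F ((extChartAt 𝓘(ℝ, E) x₀).symm z)).val)
    (Φ' := fun z ↦ (F' ((extChartAt 𝓘(ℝ, E) x₀).symm z)).val)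
    (contDiffOn_of_isParallelAt hF x₀) (contDiffOn_of_isParallelAt hF' x₀)

/-- The coordinate expression of the translation part of a 2-connection. -/
noncomputable def coordTrans (C : TwoConnection p q E M) (x₀ : M) (y : E) : E →L[ℝ] Rpq p q :=
  (transPart p q).comp (C.coordA x₀ y)

theorem differentiableAt_coordTrans (C : TwoConnection p q E M) {x₀ : M} {y : E}
    (hy : y ∈ (extChartAt 𝓘(ℝ, E) x₀).target) : DifferentiableAt ℝ (C.coordTrans x₀) y :=
  (differentiableAt_const _).clm_comp (differentiableAt_coordA hy)

theorem contDiffOn_coordTrans (C : TwoConnection p q E M) (x₀ : M) :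
    ContDiffOn ℝ ∞ (C.coordTrans x₀) (extChartAt 𝓘(ℝ, E) x₀).target :=
  contDiffOn_const.clm_comp (C.contDiffOn_coordA x₀)

theorem coordA_eq_block (C : TwoConnection p q E M) (x₀ : M) (y u : E) :
    C.coordA x₀ y u = block (C.coordLin x₀ y u) (C.coordTrans x₀ y u) 0 :=
  eq_block_of_mem_iopq (C.coordA_mem x₀ y u)

variable [IsManifold 𝓘(ℝ, E) ∞ M]

/-- The `2`-form of a 2-connection is the torsion `de + ω ∧ e`. -/
theorem B_inChart_eq (C : TwoConnection p q E M) {x₀ : M} {y : E}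
    (hy : y ∈ (extChartAt 𝓘(ℝ, E) x₀).target) (u v : E) :
    C.B.inChart x₀ y ![u, v] =
      fderiv ℝ (C.coordTrans x₀) y u v - fderiv ℝ (C.coordTrans x₀) y v u +
      (C.coordLin x₀ y u (C.coordTrans x₀ y v) - C.coordLin x₀ y v (C.coordTrans x₀ y u)) := by
  have h := congrArg (transPart p q) (C.fake_flat_coord hy u v)
  have hd : ∀ u v, fderiv ℝ (C.coordTrans x₀) y u v =
      transPart p q (fderiv ℝ (C.coordA x₀) y u v) :=
    fderiv_const_clm_comp_apply (transPart p q) (differentiableAt_coordA hy)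
  rw [transPart_tInf, map_add, map_sub, map_sub, transPart_mul (C.coordA_mem _ _ _)
    (C.coordA_mem _ _ _), transPart_mul (C.coordA_mem _ _ _) (C.coordA_mem _ _ _)] at h
  rw [hd, hd, ← h]
  rfl

/-- The 1-form `e' - Λ e` measuring the failure of a rotation field `Λ` to intertwine the
translation parts of two 2-connections. -/
noncomputable def translationDefect (C C' : TwoConnection p q E M) (Λ : M → Opq p q) :
    DiffForm E M (Rpq p q) 1 :=
  fun x ↦ (transPart p q).compContinuousAlternatingMap (C'.A x) -
    (Λ x).val.val.compContinuousAlternatingMap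
      ((transPart p q).compContinuousAlternatingMap (C.A x))

omit [IsManifold 𝓘(ℝ, E) ∞ M] in
theorem oneFormCLM_translationDefect (C C' : TwoConnection p q E M) (Λ : M → Opq p q) (x₀ : M)
    (y : E) : oneFormCLM ((translationDefect C C' Λ).inChart x₀ y) =
      C'.coordTrans x₀ y - ((fun x ↦ (Λ x).val.val) ∘ (extChartAt 𝓘(ℝ, E) x₀).symm) y ∘L
        C.coordTrans x₀ y := by
  ext1 u
  rw [oneFormCLM_apply]
  simp only [coordTrans, sub_apply, ContinuousLinearMap.comp_apply, coordA_apply]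
  rfl

omit [IsManifold 𝓘(ℝ, E) ∞ M] in
theorem smooth_translationDefect (C C' : TwoConnection p q E M) {Λ : M → Opq p q}
    (hΛ : ∀ x₀ : M, ContDiffOn ℝ ∞ ((fun x ↦ (Λ x).val.val) ∘ (extChartAt 𝓘(ℝ, E) x₀).symm)
      (extChartAt 𝓘(ℝ, E) x₀).target) : (translationDefect C C' Λ).Smooth := by
  intro x₀
  have h1 : ContDiffOn ℝ ∞ (fun y ↦ oneFormCLM ((translationDefect C C' Λ).inChart x₀ y))
      (extChartAt 𝓘(ℝ, E) x₀).target := by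
    simp only [oneFormCLM_translationDefect]
    exact (C'.contDiffOn_coordTrans x₀).sub ((hΛ x₀).clm_comp (C.contDiffOn_coordTrans x₀))
  have h2 := (oneFormCLM (E := E) (F := Rpq p q)).symm.contDiff.comp_contDiffOn h1
  refine h2.congr fun y _ ↦ ?_
  simp

end TwoConnection

end GaugeTransformation

end Teleparallel

namespace Teleparallel

section GaugeTransformation

variable {p q : ℕ} {E : Type*} [NormedAddCommGroup E] [NormedSpace ℝ E]
  {M : Type*} [TopologicalSpace M] [ChartedSpace E M]

namespace TwoConnection

theorem coordA_self [IsManifold 𝓘(ℝ, E) ∞ M] (C : TwoConnection p q E M) (x : M)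
    (u : E) : C.A x ![u] = C.coordA x (extChartAt 𝓘(ℝ, E) x x) u :=
  congr($((C.A.inChart_self x).symm) ![u]).trans (C.coordA_apply x _ u).symm

theorem translationDefect_apply [IsManifold 𝓘(ℝ, E) ∞ M] (C C' : TwoConnection p q E M)
    (Λ : M → Opq p q) (x : M) (u : E) : translationDefect C C' Λ x ![u] =
      C'.coordTrans x (extChartAt 𝓘(ℝ, E) x x) u -
        (Λ x).val.val (C.coordTrans x (extChartAt 𝓘(ℝ, E) x x) u) :=
  congrArg₂ (· - ·) (congrArg (transPart p q) (C'.coordA_self x u))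
    (congrArg (fun X ↦ (Λ x).val.val (transPart p q X)) (C.coordA_self x u))

theorem B_self [IsManifold 𝓘(ℝ, E) ∞ M] (C : TwoConnection p q E M) (x : M)
    (u v : E) : C.B x ![u, v] = C.B.inChart x (extChartAt 𝓘(ℝ, E) x x) ![u, v] :=
  congr($((C.B.inChart_self x).symm) ![u, v])

end TwoConnection

variable [IsManifold 𝓘(ℝ, E) ∞ M]

open TwoConnection

/-- Parallel frames of two 2-connections yield a weak gauge transformation between them. -/
theorem exists_gaugeTransformation_of_parallel {C C' : TwoConnection p q E M} {F F' : M → Opq p q}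
    (hF : ∀ x, C.IsParallelAt (fun y ↦ (F y).val.val) x)
    (hF' : ∀ x, C'.IsParallelAt (fun y ↦ (F' y).val.val) x) :
    ∃ T : WeakGaugeTransformation p q E M, T.Maps C C' := by
  have hblock : ContDiff ℝ ∞ (fun ξ ↦ blockLin p q ξ + block 0 0 1) :=
    (blockLin p q).contDiff.add contDiff_const
  have hsm := contDiffOn_intertwiner hF hF'
  have hsm' : ContMDiff 𝓘(ℝ, E) 𝓘(ℝ, AffEnd p q) ∞
      (fun z ↦ blockLin p q (F z * (F' z)⁻¹).val.val + block 0 0 1) :=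
    contMDiff_of_contDiffOn_symm fun x₀ : M ↦
      hblock.comp_contDiffOn (contDiffOn_intertwiner hF' hF x₀)
  -- `g` needs no translation component, since `a` absorbs the entire difference of the translation
  -- parts.
  refine ⟨{ g := fun x ↦ rotation (F' x * (F x)⁻¹)
            a := translationDefect C C' (fun x ↦ F' x * (F x)⁻¹)
            smooth_g := ?_
            smooth_a := smooth_translationDefect C C' hsm }, ?_, ?_⟩
  · simp only [affine_rotation]
    exact contMDiff_of_contDiffOn_symm fun x₀ ↦ hblock.comp_contDiffOn (hsm x₀)
  · intro x (u : E)
    dsimp only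
    have hx : extChartAt 𝓘(ℝ, E) x x ∈ (extChartAt 𝓘(ℝ, E) x).target := mem_extChartAt_target x
    set y := extChartAt 𝓘(ℝ, E) x x with hy
    have hyx : (extChartAt 𝓘(ℝ, E) x).symm y = x := extChartAt_to_inv x
    have hinv : (fun z ↦ affine (rotation (F' z * (F z)⁻¹))⁻¹) =
        fun z ↦ blockLin p q (F z * (F' z)⁻¹).val.val + block 0 0 1 := by
      funext z
      rw [rotation_inv, affine_rotation, mul_inv_rev, inv_inv]
    have hmd : MDifferentiableAt 𝓘(ℝ, E) 𝓘(ℝ, AffEnd p q)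
        (fun z ↦ blockLin p q (F z * (F' z)⁻¹).val.val + block 0 0 1) x :=
      (hsm' x).mdifferentiableAt (by simp)
    have hder := ((blockLin p q).hasFDerivAt.comp y
      (hasFDerivAt_intertwiner hF' hF hx)).add_const (block 0 0 1)
    have hd : mvfderiv 𝓘(ℝ, E) (fun z ↦ affine (rotation (F' z * (F z)⁻¹))⁻¹) x u =
        block (intertwinerDeriv (C'.coordLin x y) (C.coordLin x y)
          (F x * (F' x)⁻¹).val.val u) 0 0 := by
      rw [hyx] at hder
      rw [hinv, ← blockLin_apply]
      exact (mvfderiv_apply_eq_fderiv hmd u).trans congr($(hder.fderiv) u)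
    have hlm : (F' x * (F x)⁻¹).val.val * (F x * (F' x)⁻¹).val.val = 1 := by
      have : (F' x * (F x)⁻¹) * (F x * (F' x)⁻¹) = 1 := by group
      exact congr(($this).val.val)
    rw [hd, translationDefect_apply, coordA_self, coordA_self, ← hy, coordA_eq_block, coordA_eq_block, rotation_inv,
      affine_rotation_eq_block, affine_rotation_eq_block, mul_inv_rev, inv_inv]
    rw [tInf, block_mul_block, block_mul_block, block_mul_block, block_add_block, block_add_block]
    set l := (F' x * (F x)⁻¹).val.val
    set m := (F x * (F' x)⁻¹).val.val
    -- With `l = Λ`, `m = Λ⁻¹` and `dm = m ω' - ω m`, the terms `l ω m` cancel and `l m = 1` leaves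
    -- `ω'`. The final `0` is the linear part of `t(a)`.
    have e1 : C'.coordLin x y u = l * C.coordLin x y u * m +
        l * intertwinerDeriv (C'.coordLin x y) (C.coordLin x y) m u + 0 := by
      rw [intertwinerDeriv_apply, mul_sub, ← mul_assoc, ← mul_assoc, hlm, one_mul, add_zero]
      abel
    rw [← e1]
    -- The translation entries satisfy `l e + (e' - l e) = e'`, and the bottom entries vanish.
    congr 1
    · simp
    · simp
  · intro x (u : E) (v : E)
    dsimp only
    have hx : extChartAt 𝓘(ℝ, E) x x ∈ (extChartAt 𝓘(ℝ, E) x).target := mem_extChartAt_target x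
    set y := extChartAt 𝓘(ℝ, E) x x with hy
    have hyx : (extChartAt 𝓘(ℝ, E) x).symm y = x := extChartAt_to_inv x
    set l := (F' x * (F x)⁻¹).val.val with hl
    have hint := hasFDerivAt_intertwiner hF hF' hx
    rw [hyx, ← hl] at hint
    have hda : (translationDefect C C' (fun x ↦ F' x * (F x)⁻¹)).d x ![u, v] =
        fderiv ℝ (fun z ↦ oneFormCLM
          ((translationDefect C C' (fun x ↦ F' x * (F x)⁻¹)).inChart x z)) y u v -
        fderiv ℝ (fun z ↦ oneFormCLM
          ((translationDefect C C' (fun x ↦ F' x * (F x)⁻¹)).inChart x z)) y v u :=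
      congr($((smooth_translationDefect C C' hsm).d_apply x) ![u, v]).trans
        (extDeriv_oneForm_apply u v)
    simp only [oneFormCLM_translationDefect] at hda
    rw [fderiv_sub_clm_comp_apply hint (C.differentiableAt_coordTrans hx)
      (C'.differentiableAt_coordTrans hx), fderiv_sub_clm_comp_apply hint
      (C.differentiableAt_coordTrans hx) (C'.differentiableAt_coordTrans hx),
      Function.comp_apply, hyx, ← hl] at hda
    have hα : ∀ (u : E) w, alphaInf (C'.A x ![u]) w = C'.coordLin x y u w :=
      fun u w ↦ by
        rw [coordA_self]
        rfl
    have hlv : ∀ z w : Rpq p q, ⁅z, w⁆ = 0 := fun z w ↦ by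
      funext i
      simp [LieRing.of_associative_ring_bracket, mul_comm]
    have hcov : ∀ a : DiffForm E M (Rpq p q) 1, covariantD C'.A a x u v =
        a.d x ![u, v] + (alphaInf (C'.A x ![u]) (a x ![v]) - alphaInf (C'.A x ![v]) (a x ![u])) :=
      fun _ ↦ rfl
    rw [hlv, add_zero, hcov, hda, hα, hα, translationDefect_apply,
      translationDefect_apply, B_self, B_self, C.B_inChart_eq hx, C'.B_inChart_eq hx,
      alpha_rotation, ← hy, ← hl]
    -- Here `da = de' - dΛ ∧ e - Λ de` with `dΛ = Λ ω - ω' Λ`. Adding `ω' ∧ (e' - Λ e)` and `Λ (de +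
    -- ω ∧ e)` leaves `de' + ω' ∧ e' = B'`.
    simp only [intertwinerDeriv_apply, map_add, map_sub, sub_apply, mul_apply_eq_comp]
    abel

end GaugeTransformation

end Teleparallel

theorem mainTheorem5 (p q : ℕ)
    (E : Type*) [NormedAddCommGroup E] [NormedSpace ℝ E] [FiniteDimensional ℝ E]
    (M : Type*) [TopologicalSpace M] [ChartedSpace E M] [IsManifold 𝓘(ℝ, E) ∞ M]
    (hM : ∀ x : M, Subsingleton (FundamentalGroup M x))
    (C C' : Teleparallel.TwoConnection p q E M) :
    ∃ T : Teleparallel.WeakGaugeTransformation p q E M, T.Maps C C' := by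
  obtain ⟨F, hF⟩ := C.exists_parallel hM
  obtain ⟨F', hF'⟩ := C'.exists_parallel hM
  exact Teleparallel.exists_gaugeTransformation_of_parallel hF hF'
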